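/- Let $d\ge 1$ and $\mathcal H=\mathbb C^d$. A POVM on a finite-dimensional Hilbert space is a finite family of positive semidefinite operators summing to the identity. A POVM $\mathscr A=\{A_j\}_j$ is a coarse graining of $\mathscr C=\{C_k\}_k$ if $A_j=\sum_k\Lambda_{jk}C_k$ for some real matrix $\Lambda$ with $\Lambda_{jk}\ge 0$ and $\sum_j\Lambda_{jk}=1$ for all $k$; two POVMs $\mathscr A,\mathscr B$ on $\mathcal H$ are compatible (jointly measurable) if both are coarse grainings of one common POVM on $\mathcal H$. A POVM is simple if no element is proportional to another element. A SIC is a POVM with $d^2$ elements $\frac1d|\psi_j\rangle\langle\psi_j|$, where the $\psi_j$ are unit vectors with $|\langle\psi_j|\psi_k\rangle|^2=\frac1{d+1}$ for all $j\ne k$. For a POVM $\mathscr M=\{M_j\}_j$ on $\mathcal H^{\otimes 2}$, the two-copy estimation fidelity is $$F(\mathscr M)=\max_{\{\hat\rho_j\}}\ \sum_j\int \operatorname{tr}\bigl[(|\psi\rangle\langle\psi|)^{\otimes 2}M_j\bigr]\,\operatorname{tr}\bigl[|\psi\rangle\langle\psi|\,\hat\rho_j\bigr]\,d\mu(\psi),$$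 where $\mu$ is the normalized unitarily invariant measure on pure states of $\mathcal H$ and the maximum is over all families of density operators $\hat\rho_j$ on $\mathcal H$. Put $$F_2^{\mathrm{iid}}=\frac{2\left[d^2+d+1+(d-1)\sqrt{d+1}\right]}{d(d+1)(d+2)}.$$ Let $\mathscr A=\{A_j\}_j$ and $\mathscr B=\{B_k\}_k$ be POVMs on $\mathcal H$, and let $\mathscr A\otimes\mathscr B=\{A_j\otimes B_k\}_{j,k}$. If $\mathscr A$ and $\mathscr B$ are compatible, then $F(\mathscr A\otimes\mathscr B)\le F_2^{\mathrm{iid}}$. If in addition both $\mathscr A$ and $\mathscr B$ are simple, then equality holds if and only if $\mathscr A$ and $\mathscr B$ are identical SICs up to relabeling of the outcomes. In particular, $F(\mathscr A\otimes\mathscr B)>F_2^{\mathrm{iid}}$ implies that $\mathscr A$ and $\mathscr B$ are incompatible. -/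

import Mathlib

open scoped ComplexOrder Kronecker

/-- A POVM with outcome set `ι` on the Hilbert space `ℂⁿ` (operators are `n × n` complex matrices):
a finite family of positive semidefinite operators that sum up to the identity. -/
structure POVM (ι n : Type*) [Fintype ι] [Fintype n] [DecidableEq n] where
  elem : ι → Matrix n n ℂ
  posSemidef : ∀ j, (elem j).PosSemidef
  sum_elem : ∑ j, elem j = 1

/-- The (mixed) quantum states on `ℂᵈ`: positive semidefinite operators of trace one. -/
structure DensityOperator (d : ℕ) where
  mat : Matrix (Fin d) (Fin d) ℂ
  posSemidef : mat.PosSemidef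
  trace_eq_one : mat.trace = 1

/-- The unit vectors of `ℂᵈ`. -/
abbrev PureState (d : ℕ) : Type := Metric.sphere (0 : EuclideanSpace ℂ (Fin d)) 1

/-- The rank-one operator `|ψ⟩⟨ψ|`. -/
def ketBra {d : ℕ} (ψ : EuclideanSpace ℂ (Fin d)) : Matrix (Fin d) (Fin d) ℂ :=
  Matrix.of fun a b => ψ a * star (ψ b)

/-- The normalized (unitarily invariant) surface measure on the unit sphere of `ℂᵈ`, that is, the
distribution of a Haar-random pure state. -/
noncomputable def haarPureState (d : ℕ) : MeasureTheory.Measure (PureState d) :=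
  ((MeasureTheory.volume : MeasureTheory.Measure (EuclideanSpace ℂ (Fin d))).toSphere Set.univ)⁻¹ •
    (MeasureTheory.volume : MeasureTheory.Measure (EuclideanSpace ℂ (Fin d))).toSphere

namespace POVM

variable {ι κ m n : Type*} [Fintype ι] [Fintype κ] [Fintype m] [DecidableEq m] [Fintype n]
  [DecidableEq n]

/-- `A ≼ B`: `A` is a coarse graining of `B`, that is, `A_j = ∑_k Λ_{jk} B_k` for a stochastic
matrix `Λ` (nonnegative entries, `∑_j Λ_{jk} = 1`). -/
def IsCoarseGraining (A : POVM ι n) (B : POVM κ n) : Prop :=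
  ∃ L : ι → κ → ℝ, (∀ j k, 0 ≤ L j k) ∧ (∀ k, ∑ j, L j k = 1) ∧
    ∀ j, A.elem j = ∑ k, (L j k : ℂ) • B.elem k

/-- Two POVMs are compatible (jointly measurable) if they have a common refinement. -/
def Compatible (A : POVM ι n) (B : POVM κ n) : Prop :=
  ∃ (r : ℕ) (C : POVM (Fin r) n), A.IsCoarseGraining C ∧ B.IsCoarseGraining C

/-- A POVM is simple if no element is proportional to another element (in particular, as soon as
there are two outcomes, no element is zero). -/
def IsSimple (A : POVM ι n) : Prop :=
  ∀ j k, j ≠ k → ∀ c : ℂ, A.elem j ≠ c • A.elem k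

/-- A SIC: the `d²` elements are `|ψ_j⟩⟨ψ_j| / d`, where the `ψ_j` are unit vectors with all pairwise
fidelities equal to `1 / (d + 1)`. -/
def IsSIC {d : ℕ} (A : POVM ι (Fin d)) : Prop :=
  Fintype.card ι = d ^ 2 ∧ ∃ ψ : ι → EuclideanSpace ℂ (Fin d),
    (∀ j, ‖ψ j‖ = 1) ∧
    (∀ j k, j ≠ k → ‖inner ℂ (ψ j) (ψ k)‖ ^ 2 = 1 / ((d : ℝ) + 1)) ∧
    ∀ j, A.elem j = (1 / (d : ℂ)) • ketBra (ψ j)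

/-- Two POVMs are identical up to relabeling of the outcomes. -/
def IdenticalUpToRelabeling (A : POVM ι n) (B : POVM κ n) : Prop :=
  ∃ e : ι ≃ κ, ∀ j, A.elem j = B.elem (e j)

/-- The product POVM `A ⊗ B`, with elements `A_j ⊗ B_k`. -/
def prod (A : POVM ι m) (B : POVM κ n) : POVM (ι × κ) (m × n) where
  elem p := A.elem p.1 ⊗ₖ B.elem p.2
  posSemidef p := (A.posSemidef p.1).kronecker (B.posSemidef p.2)
  sum_elem := by
    have h : ∑ p : ι × κ, A.elem p.1 ⊗ₖ B.elem p.2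
        = (∑ j, A.elem j) ⊗ₖ (∑ k, B.elem k) := by
      ext a b
      simp only [Matrix.sum_apply, Matrix.kroneckerMap_apply, Fintype.sum_prod_type,
        Finset.sum_mul_sum]
    rw [h, A.sum_elem, B.sum_elem, Matrix.one_kronecker_one]

/-- The average fidelity of the following estimation strategy: two copies of a Haar-random pure
state `ρ = |ψ⟩⟨ψ|` on `ℂᵈ` are measured by the POVM `A` on `ℂᵈ ⊗ ℂᵈ`; outcome `j` occurs with
probability `tr((ρ ⊗ ρ) A_j)`, the estimator is then `est j`, and the fidelity is `tr(ρ (est j))`.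
(Both traces are real.) -/
noncomputable def avgFidelity {d : ℕ} (A : POVM ι (Fin d × Fin d)) (est : ι → DensityOperator d) :
    ℝ :=
  ∑ j, ∫ ψ : PureState d,
    ((ketBra ψ.1 ⊗ₖ ketBra ψ.1) * A.elem j).trace.re * (ketBra ψ.1 * (est j).mat).trace.re
      ∂(haarPureState d)

/-- The (two-copy) estimation fidelity `F(A)`: the maximum of the average fidelity over all
choices of the estimators. -/
noncomputable def estimationFidelity {d : ℕ} (A : POVM ι (Fin d × Fin d)) : ℝ :=
  ⨆ est : ι → DensityOperator d, A.avgFidelity est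

end POVM

/-- The value `F₂ⁱⁱᵈ` in dimension `d`. -/
noncomputable def F2iid (d : ℕ) : ℝ :=
  2 * ((d : ℝ) ^ 2 + d + 1 + (d - 1) * Real.sqrt (d + 1)) / (d * (d + 1) * (d + 2))

/-!
By the third moment of a Haar-random pure state, the score of the outcome `(j, k)` of `A ⊗ B` is a
constant plus `tr(ρ Q(A_j, B_k))` with `Q(A, B) = tr(A) B + tr(B) A + A B + B A`, where `ρ` is the
estimator. Compatible POVMs refine to one rank-one POVM `{w_r |x_r⟩⟨x_r|}`, for which the optimal
`ρ` at the pair `r, s` gives `(1 + |⟪x_r, x_s⟫|) ^ 2`. As the weighted moments of order `0` and `2`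
of the overlaps are `d ^ 2` and `d`, only the first moment is left to be bounded. It is controlled
by a quartic that touches a line at `1 / √(d + 1)` and meets it again at `1`, together with the
Welch bound on the fourth moment.

When the bound is attained, every overlap is `1` or `1 / √(d + 1)`. Moreover, all refined outcomes
lumped into the same outcome share an optimal estimator, which forces their vectors to be parallel;
a simple POVM obtained in this way is a SIC.
-/

section Polarization

open Finset

variable {α R : Type*} [Fintype α] [DecidableEq α] [CommRing R]

theorem sum_neg_one_pow_card_compl_filter_range_subset (f : α → α) :
    ∑ s : Finset α with ∀ j, f j ∈ s, (-1 : R) ^ #sᶜ = if f.Bijective then 1 else 0 := by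
  have hrange : (univ.image f)ᶜ = ∅ ↔ f.Bijective := by
    rw [compl_eq_empty_iff, eq_univ_iff_forall, ← Finite.surjective_iff_bijective]
    simp only [mem_image, mem_univ, true_and, Function.Surjective]
  have hcompl : ∑ s : Finset α with ∀ j, f j ∈ s, (-1 : R) ^ #sᶜ
      = ∑ t ∈ ((univ.image f)ᶜ).powerset, (-1 : R) ^ #t :=
    sum_nbij' compl compl
      (fun s hs => by
        rw [mem_powerset, compl_subset_compl, image_subset_iff]
        exact fun j _ => (mem_filter.1 hs).2 j)
      (fun t ht => by
        rw [mem_powerset, subset_compl_comm, image_subset_iff] at ht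
        exact mem_filter.2 ⟨mem_univ _, fun j => ht j (mem_univ j)⟩)
      (by simp) (by simp) (by simp)
  have hsum := congrArg (Int.cast : ℤ → R) (sum_powerset_neg_one_pow_card (x := (univ.image f)ᶜ))
  simp only [hrange] at hsum
  rw [hcompl]
  exact_mod_cast hsum

theorem ryser_formula (a : Matrix α α R) :
    ∑ s : Finset α, (-1) ^ #sᶜ * ∏ j, ∑ i ∈ s, a i j = a.permanent := by
  calc ∑ s : Finset α, (-1) ^ #sᶜ * ∏ j, ∑ i ∈ s, a i j
      = ∑ s : Finset α, ∑ f : α → α,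
          if ∀ j, f j ∈ s then (-1) ^ #sᶜ * ∏ j, a (f j) j else 0 := by
        refine sum_congr rfl fun s _ => ?_
        rw [prod_univ_sum, mul_sum, ← sum_filter]
        exact sum_congr (by ext f; simp) fun _ _ => rfl
    _ = ∑ f : α → α, if f.Bijective then ∏ j, a (f j) j else 0 := by
        rw [sum_comm]
        refine sum_congr rfl fun f _ => ?_
        rw [← sum_filter, ← sum_mul, sum_neg_one_pow_card_compl_filter_range_subset, ite_mul,
          one_mul, zero_mul]
    _ = a.permanent := by
        rw [← sum_filter, Matrix.permanent]
        exact sum_bij (fun f hf => Equiv.ofBijective f (mem_filter.1 hf).2) (fun _ _ => mem_univ _)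
          (fun _ _ _ _ h => by injection h)
          (fun σ _ => ⟨σ, mem_filter.2 ⟨mem_univ _, σ.bijective⟩, Equiv.coe_inj.1 rfl⟩)
          fun _ _ => rfl

theorem sum_neg_one_pow_card_compl_mul_sum_pow_card (a : α → R) :
    ∑ s : Finset α, (-1) ^ #sᶜ * (∑ i ∈ s, a i) ^ Fintype.card α
      = (Fintype.card α).factorial * ∏ i, a i := by
  have h := ryser_formula (Matrix.of fun i (_ : α) => a i)
  simpa [Matrix.permanent, Equiv.prod_comp, Fintype.card_perm] using h

end Polarization

section RootsOfUnity

open Finset ComplexConjugate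

theorem sum_eval_pow_of_isPrimitiveRoot {R : Type*} [CommRing R] [IsDomain R] {ζ : R} {n : ℕ}
    (hζ : IsPrimitiveRoot ζ n) {P : Polynomial R} (hP : P.natDegree < n) :
    ∑ k ∈ range n, P.eval (ζ ^ k) = n * P.coeff 0 := by
  have hpow : ∀ i ∈ range n, ∑ k ∈ range n, (ζ ^ k) ^ i = if i = 0 then (n : R) else 0 := by
    intro i hi
    split_ifs with h0
    · simp [h0]
    · have hne : ζ ^ i ≠ 1 := hζ.pow_ne_one_of_pos_of_lt h0 (mem_range.1 hi)
      have hgeom : (ζ ^ i - 1) * ∑ k ∈ range n, (ζ ^ i) ^ k = 0 := by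
        rw [mul_geom_sum, pow_right_comm, hζ.pow_eq_one, one_pow, sub_self]
      simpa only [pow_right_comm] using (mul_eq_zero.1 hgeom).resolve_left (sub_ne_zero.2 hne)
  simp only [Polynomial.eval_eq_sum_range' hP]
  rw [sum_comm]
  simp only [← mul_sum]
  rw [sum_congr rfl fun i hi => by rw [hpow i hi]]
  have : n ≠ 0 := by omega
  simp [this, mul_comm]

variable {E : Type*} [SeminormedAddCommGroup E] [InnerProductSpace ℂ E]

theorem natCast_mul_inner_pow_eq_sum {ζ : ℂ} {n t : ℕ}
    (hζ : IsPrimitiveRoot ζ n) (hn : 2 * t < n) (x y : E) :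
    (n : ℂ) * inner ℂ x y ^ t
      = ∑ k ∈ range n, ζ ^ (k * t) * ((‖y + ζ ^ k • x‖ ^ (2 * t) : ℝ) : ℂ) := by
  open Polynomial in
  let P : ℂ[X] :=
    (C (inner ℂ x y) + C (inner ℂ x x + inner ℂ y y) * X + C (inner ℂ y x) * X ^ 2) ^ t
  have hdeg : P.natDegree < n := by
    refine lt_of_le_of_lt (Polynomial.natDegree_pow_le_of_le t (m := 2) ?_) (by omega)
    compute_degree
  have hcoeff : P.coeff 0 = inner ℂ x y ^ t := by
    simp [P, Polynomial.coeff_zero_eq_eval_zero]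
  have heval : ∀ k, P.eval (ζ ^ k) = ζ ^ (k * t) * ((‖y + ζ ^ k • x‖ ^ (2 * t) : ℝ) : ℂ) := by
    intro k
    have hconj : conj (ζ ^ k) * ζ ^ k = 1 := by
      rw [Complex.conj_mul', norm_pow, hζ.norm'_eq_one (by omega)]
      simp
    have hsq : ((‖y + ζ ^ k • x‖ ^ 2 : ℝ) : ℂ) = inner ℂ (y + ζ ^ k • x) (y + ζ ^ k • x) := by
      rw [inner_self_eq_norm_sq_to_K]; simp
    rw [pow_mul, pow_mul, Complex.ofReal_pow, hsq, ← mul_pow]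
    simp only [P, Polynomial.eval_pow, Polynomial.eval_add, Polynomial.eval_C, Polynomial.eval_mul,
      Polynomial.eval_X, inner_add_left, inner_add_right, inner_smul_left, inner_smul_right]
    congr 1
    linear_combination (-(inner ℂ x y) - ζ ^ k * inner ℂ x x) * hconj
  rw [← hcoeff, ← sum_eval_pow_of_isPrimitiveRoot hζ hdeg]
  exact sum_congr rfl fun k _ => heval k

end RootsOfUnity

section UnitarilyInvariant

open MeasureTheory Metric Set

/-- The homeomorphism of the unit sphere induced by a linear isometry. -/
def unitSphereHomeomorph {𝕜 E : Type*} [NormedField 𝕜] [SeminormedAddCommGroup E] [NormedSpace 𝕜 E]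
    (U : E ≃ₗᵢ[𝕜] E) : sphere (0 : E) 1 ≃ₜ sphere (0 : E) 1 :=
  U.toHomeomorph.subtype fun x => by simp

open scoped Pointwise in
theorem measurePreserving_unitSphereHomeomorph_toSphere {E : Type*} [NormedAddCommGroup E]
    [NormedSpace ℝ E] [MeasurableSpace E] [BorelSpace E] {μ : Measure E} {U : E ≃ₗᵢ[ℝ] E}
    (hU : MeasurePreserving U μ μ) :
    MeasurePreserving (unitSphereHomeomorph U) μ.toSphere μ.toSphere := by
  have hcone : ∀ s : Set (sphere (0 : E) 1),
      U ⁻¹' (Ioo (0 : ℝ) 1 • (Subtype.val '' s))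
        = Ioo (0 : ℝ) 1 • (Subtype.val '' (unitSphereHomeomorph U ⁻¹' s)) := by
    intro s
    ext x
    simp only [mem_preimage, mem_smul, mem_image]
    constructor
    · rintro ⟨r, hr, _, ⟨y, hy, rfl⟩, hxy⟩
      refine ⟨r, hr, _, ⟨(unitSphereHomeomorph U).symm y, by simpa using hy, rfl⟩, ?_⟩
      exact U.injective (by simpa [unitSphereHomeomorph] using hxy)
    · rintro ⟨r, hr, _, ⟨y, hy, rfl⟩, rfl⟩
      exact ⟨r, hr, _, ⟨_, hy, rfl⟩, (map_smul U r y.1).symm⟩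
  have hmeas := (unitSphereHomeomorph U).continuous.measurable
  refine ⟨hmeas, Measure.ext fun s hs => ?_⟩
  rw [Measure.map_apply hmeas hs, Measure.toSphere_apply' _ hs,
    Measure.toSphere_apply' _ (hmeas hs), ← hcone,
    hU.measure_preimage_emb U.toHomeomorph.measurableEmbedding]

theorem integrable_of_continuous {X F : Type*} [TopologicalSpace X] [CompactSpace X]
    [MeasurableSpace X] [OpensMeasurableSpace X] [NormedAddCommGroup F]
    [SecondCountableTopologyEither X F] {ν : Measure X} [IsFiniteMeasure ν] {f : X → F}
    (hf : Continuous f) : Integrable f ν :=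
  hf.integrable_of_hasCompactSupport (HasCompactSupport.of_compactSpace f)

theorem exists_linearIsometryEquiv_eq_norm_smul {E : Type*} [NormedAddCommGroup E]
    [InnerProductSpace ℂ E] [FiniteDimensional ℂ E] {e : E} (he : ‖e‖ = 1) (u : E) :
    ∃ U : E ≃ₗᵢ[ℂ] E, u = (‖u‖ : ℂ) • U e := by
  rcases eq_or_ne u 0 with rfl | hu
  · exact ⟨LinearIsometryEquiv.refl ℂ E, by simp⟩
  have hv : ‖(‖u‖⁻¹ : ℂ) • u‖ = 1 := by simp [norm_smul, hu]
  let L : (ℂ ∙ e) →ₗᵢ[ℂ] E := (Submodule.subtypeₗᵢ _).comp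
    ((LinearIsometryEquiv.toSpanUnitSingleton e he).symm.trans
      (LinearIsometryEquiv.toSpanUnitSingleton _ hv)).toLinearIsometry
  have he1 : (LinearIsometryEquiv.toSpanUnitSingleton (𝕜 := ℂ) e he).symm
      ⟨e, Submodule.mem_span_singleton_self e⟩ = 1 := by
    rw [LinearIsometryEquiv.symm_apply_eq]; simp
  have hL : L ⟨e, Submodule.mem_span_singleton_self e⟩ = (‖u‖⁻¹ : ℂ) • u := by
    simp [L, he1]
  refine ⟨L.extend.toLinearIsometryEquiv rfl, ?_⟩
  have := L.extend_apply ⟨e, Submodule.mem_span_singleton_self e⟩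
  simp_all

variable {E : Type*} [NormedAddCommGroup E] [InnerProductSpace ℂ E] [MeasurableSpace E]

/-- A measure on the unit sphere of a complex inner product space is unitarily invariant if every
linear isometry of the space preserves it. -/
def IsUnitarilyInvariant (μ : Measure (sphere (0 : E) 1)) : Prop :=
  ∀ U : E ≃ₗᵢ[ℂ] E, MeasurePreserving (unitSphereHomeomorph U) μ μ

theorem isUnitarilyInvariant_haarPureState (d : ℕ) : IsUnitarilyInvariant (haarPureState d) := by
  intro U
  let V : EuclideanSpace ℂ (Fin d) ≃ₗᵢ[ℝ] EuclideanSpace ℂ (Fin d) :=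
    { U.toLinearEquiv.restrictScalars ℝ with norm_map' := U.norm_map }
  exact (measurePreserving_unitSphereHomeomorph_toSphere V.measurePreserving).smul_measure _

instance isFiniteMeasure_haarPureState (d : ℕ) : IsFiniteMeasure (haarPureState d) := by
  unfold haarPureState; infer_instance

instance isProbabilityMeasure_haarPureState (d : ℕ) [NeZero d] :
    IsProbabilityMeasure (haarPureState d) :=
  have : NeZero (volume : Measure (EuclideanSpace ℂ (Fin d))).toSphere :=
    ⟨Measure.toSphere_ne_zero _⟩
  MeasureTheory.isProbabilityMeasureSMul

variable [BorelSpace E] [FiniteDimensional ℂ E] {μ : Measure (sphere (0 : E) 1)}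

theorem IsUnitarilyInvariant.exists_integral_norm_inner_pow_eq [Nontrivial E]
    (hμ : IsUnitarilyInvariant μ) (n : ℕ) :
    ∃ m : ℝ, ∀ u : E, ∫ ψ : sphere (0 : E) 1, ‖inner ℂ ψ.1 u‖ ^ n ∂μ = m * ‖u‖ ^ n := by
  obtain ⟨e, he⟩ := exists_norm_eq E zero_le_one
  refine ⟨∫ ψ : sphere (0 : E) 1, ‖inner ℂ ψ.1 e‖ ^ n ∂μ, fun u => ?_⟩
  obtain ⟨U, hU⟩ := exists_linearIsometryEquiv_eq_norm_smul he u
  calc ∫ ψ : sphere (0 : E) 1, ‖inner ℂ ψ.1 u‖ ^ n ∂μ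
      = ∫ ψ : sphere (0 : E) 1, ‖inner ℂ (unitSphereHomeomorph U ψ).1 u‖ ^ n ∂μ :=
        ((hμ U).integral_comp (unitSphereHomeomorph U).measurableEmbedding _).symm
    _ = ∫ ψ : sphere (0 : E) 1, ‖inner ℂ ψ.1 e‖ ^ n * ‖u‖ ^ n ∂μ := by
        refine integral_congr_ae (.of_forall fun ψ => ?_)
        have hinner : inner ℂ (unitSphereHomeomorph U ψ).1 u = ‖u‖ * inner ℂ ψ.1 e := by
          conv_lhs => rw [hU, inner_smul_right]
          exact congrArg _ (U.inner_map_map ψ.1 e)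
        simp only [hinner, norm_mul, Complex.norm_real, norm_norm, mul_pow, mul_comm]
    _ = _ := integral_mul_const _ _

theorem IsUnitarilyInvariant.exists_integral_inner_pow_mul_inner_pow_eq [Nontrivial E]
    [IsFiniteMeasure μ] (hμ : IsUnitarilyInvariant μ) (t : ℕ) :
    ∃ m : ℂ, ∀ x y : E, ∫ ψ : sphere (0 : E) 1, inner ℂ x ψ.1 ^ t * inner ℂ ψ.1 y ^ t ∂μ
      = m * inner ℂ x y ^ t := by
  obtain ⟨m, hm⟩ := hμ.exists_integral_norm_inner_pow_eq (2 * t)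
  refine ⟨m, fun x y => ?_⟩
  have hζ := Complex.isPrimitiveRoot_exp (2 * t + 1) (by omega)
  set ζ := Complex.exp (2 * Real.pi * Complex.I / (2 * t + 1 : ℕ))
  have hpol : ∀ ψ : sphere (0 : E) 1,
      ((2 * t + 1 : ℕ) : ℂ) * (inner ℂ x ψ.1 ^ t * inner ℂ ψ.1 y ^ t)
        = ∑ k ∈ Finset.range (2 * t + 1),
          ζ ^ (k * t) * ((‖inner ℂ ψ.1 (y + ζ ^ k • x)‖ ^ (2 * t) : ℝ) : ℂ) := by
    intro ψ
    have h := natCast_mul_inner_pow_eq_sum (t := t) hζ (by omega) (inner ℂ ψ.1 x) (inner ℂ ψ.1 y)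
    simpa only [inner_add_right, inner_smul_right, smul_eq_mul, RCLike.inner_apply, inner_conj_symm,
      mul_pow, mul_comm] using h
  refine mul_left_cancel₀ (Nat.cast_ne_zero.2 (2 * t).succ_ne_zero) ?_
  rw [← integral_const_mul]
  simp only [hpol]
  rw [integral_finsetSum _ fun k _ => integrable_of_continuous (by fun_prop)]
  simp only [integral_const_mul, integral_complex_ofReal, hm]
  rw [mul_left_comm, natCast_mul_inner_pow_eq_sum (t := t) hζ (by omega) x y, Finset.mul_sum]
  simp only [Complex.ofReal_mul, mul_left_comm]

theorem factorial_card_mul_integral_prod_mul {X α : Type*} [MeasurableSpace X] [Fintype α]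
    [DecidableEq α] {ν : Measure X} (f : α → X → ℂ) (w : X → ℂ)
    (hf : ∀ s : Finset α, Integrable (fun ψ => (∑ i ∈ s, f i ψ) ^ Fintype.card α * w ψ) ν) :
    (Fintype.card α).factorial * ∫ ψ, (∏ i, f i ψ) * w ψ ∂ν
      = ∑ s : Finset α, (-1) ^ sᶜ.card * ∫ ψ, (∑ i ∈ s, f i ψ) ^ Fintype.card α * w ψ ∂ν := by
  simp only [← integral_const_mul, ← mul_assoc]
  simp only [← sum_neg_one_pow_card_compl_mul_sum_pow_card, Finset.sum_mul, mul_assoc]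
  exact integral_finsetSum _ fun s _ => (hf s).const_mul _

theorem IsUnitarilyInvariant.exists_integral_prod_inner_mul_prod_inner_eq [Nontrivial E]
    [IsFiniteMeasure μ] (hμ : IsUnitarilyInvariant μ) (α : Type*) [Fintype α] [DecidableEq α] :
    ∃ m : ℂ, ∀ x y : α → E,
      ∫ ψ : sphere (0 : E) 1, (∏ i, inner ℂ (x i) ψ.1) * ∏ i, inner ℂ ψ.1 (y i) ∂μ
        = m * (Matrix.of fun i j => inner ℂ (x i) (y j)).permanent := by
  obtain ⟨m, hm⟩ := hμ.exists_integral_inner_pow_mul_inner_pow_eq (Fintype.card α)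
  refine ⟨m / (Fintype.card α).factorial, fun x y => ?_⟩
  have hfac : ((Fintype.card α).factorial : ℂ) ≠ 0 := Nat.cast_ne_zero.2 (Nat.factorial_ne_zero _)
  have hpow : ∀ v : E,
      ∫ ψ : sphere (0 : E) 1, inner ℂ ψ.1 v ^ Fintype.card α * ∏ i, inner ℂ (x i) ψ.1 ∂μ
        = m * ∏ i, inner ℂ (x i) v := by
    intro v
    refine mul_left_cancel₀ hfac ?_
    simp only [mul_comm (inner ℂ _ v ^ _)]
    rw [factorial_card_mul_integral_prod_mul (fun i (ψ : sphere (0 : E) 1) => inner ℂ (x i) ψ.1)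
      _ fun s => integrable_of_continuous (by fun_prop)]
    simp only [← sum_inner, hm, mul_left_comm _ m, ← Finset.mul_sum]
    simp only [sum_inner, sum_neg_one_pow_card_compl_mul_sum_pow_card]
  refine mul_left_cancel₀ hfac ?_
  simp only [mul_comm (∏ i, inner ℂ (x i) _)]
  rw [factorial_card_mul_integral_prod_mul (fun i (ψ : sphere (0 : E) 1) => inner ℂ ψ.1 (y i))
    _ fun s => integrable_of_continuous (by fun_prop), ← mul_assoc,
    mul_div_cancel₀ _ hfac, ← Matrix.permanent_transpose, ← ryser_formula]
  simp only [← inner_sum, hpow, mul_left_comm _ m, ← Finset.mul_sum]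
  simp only [inner_sum, Matrix.transpose_apply, Matrix.of_apply]

end UnitarilyInvariant

section TraceMoments

open MeasureTheory Matrix

open Equiv in
theorem permanent_fin_three {R : Type*} [CommRing R] (A : Matrix (Fin 3) (Fin 3) R) :
    A.permanent = A 0 0 * A 1 1 * A 2 2 + A 0 0 * A 1 2 * A 2 1 + A 0 1 * A 1 0 * A 2 2
      + A 0 1 * A 1 2 * A 2 0 + A 1 0 * A 0 2 * A 2 1 + A 1 1 * A 0 2 * A 2 0 := by
  have huniv : (Finset.univ : Finset (Perm (Fin 3)))
      = {1, swap 0 1, swap 0 2, swap 1 2, swap 0 1 * swap 1 2, swap 1 2 * swap 0 1} := by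
    decide
  rw [permanent, huniv, Finset.sum_insert (by decide), Finset.sum_insert (by decide),
    Finset.sum_insert (by decide), Finset.sum_insert (by decide), Finset.sum_insert (by decide),
    Finset.sum_singleton]
  simp only [Fin.prod_univ_three, swap_apply_def, Perm.mul_apply, Perm.one_apply, Fin.reduceEq,
    if_true, if_false]
  ring

theorem sum_fin_three_arrow {ι M : Type*} [Fintype ι] [AddCommMonoid M] (f : (Fin 3 → ι) → M) :
    ∑ a, f a = ∑ i, ∑ j, ∑ k, f ![i, j, k] := by
  have hcons : ∀ {n : ℕ} (g : (Fin (n + 1) → ι) → M), ∑ a, g a = ∑ i, ∑ a, g (vecCons i a) :=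
    fun g => by rw [← (Fin.consEquiv fun _ => ι).sum_comp, Fintype.sum_prod_type]; rfl
  rw [hcons]
  simp_rw [hcons (n := 1), hcons (n := 0), Fintype.sum_unique]
  rfl

variable {d : ℕ}

theorem ketBra_eq_vecMulVec (ψ : EuclideanSpace ℂ (Fin d)) : ketBra ψ = vecMulVec ψ (star ⇑ψ) :=
  rfl

theorem trace_ketBra (ψ : EuclideanSpace ℂ (Fin d)) : (ketBra ψ).trace = (‖ψ‖ : ℂ) ^ 2 := by
  rw [ketBra_eq_vecMulVec, trace_vecMulVec]
  exact inner_self_eq_norm_sq_to_K ψ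

theorem trace_ketBra_pureState (ψ : PureState d) : (ketBra ψ.1).trace = 1 := by
  simp [trace_ketBra]

@[fun_prop]
theorem continuous_trace_ketBra_mul (A : Matrix (Fin d) (Fin d) ℂ) :
    Continuous fun ψ : PureState d => (ketBra ψ.1 * A).trace := by
  have hket : Continuous fun ψ : PureState d => ketBra ψ.1 :=
    continuous_matrix fun a b => by simp only [ketBra, of_apply]; fun_prop
  exact (hket.matrix_mul continuous_const).matrix_trace

theorem trace_ketBra_mul (ψ : EuclideanSpace ℂ (Fin d)) (A : Matrix (Fin d) (Fin d) ℂ) :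
    (ketBra ψ * A).trace
      = ∑ a, inner ℂ (EuclideanSpace.single a 1) ψ * inner ℂ ψ (WithLp.toLp 2 (A.col a)) := by
  simp [trace, mul_apply, ketBra, PiLp.inner_apply, Finset.mul_sum, mul_left_comm, mul_comm]

theorem exists_integral_prod_trace_ketBra_mul_eq [NeZero d] (α : Type*) [Fintype α]
    [DecidableEq α] :
    ∃ m : ℂ, ∀ A : α → Matrix (Fin d) (Fin d) ℂ,
      ∫ ψ : PureState d, ∏ i, (ketBra ψ.1 * A i).trace ∂(haarPureState d)
        = m * ∑ a : α → Fin d, (of fun i j => A j (a i) (a j)).permanent := by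
  obtain ⟨m, hm⟩ :=
    (isUnitarilyInvariant_haarPureState d).exists_integral_prod_inner_mul_prod_inner_eq α
  refine ⟨m, fun A => ?_⟩
  simp only [trace_ketBra_mul, Finset.prod_univ_sum, Fintype.piFinset_univ, Finset.prod_mul_distrib]
  rw [integral_finsetSum _ fun a _ => integrable_of_continuous (by fun_prop)]
  simp only [hm, ← Finset.mul_sum]
  simp only [EuclideanSpace.inner_single_left, map_one, one_mul, col_apply]

/-- The symmetric bilinear map `(A, B) ↦ tr(A) B + tr(B) A + A B + B A`. When two copies of a
Haar-random pure state are measured by `A ⊗ B`, it collects the part of the third moment of the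
state that depends on the estimator. -/
noncomputable def fidelityOperator :
    Matrix (Fin d) (Fin d) ℂ →ₗ[ℂ] Matrix (Fin d) (Fin d) ℂ →ₗ[ℂ] Matrix (Fin d) (Fin d) ℂ :=
  LinearMap.mk₂ ℂ (fun A B => A.trace • B + B.trace • A + A * B + B * A)
    (fun A A' B => by simp only [trace_add, add_mul, mul_add, add_smul, smul_add]; abel)
    (fun c A B => by simp [smul_smul, mul_comm])
    (fun A B B' => by simp only [trace_add, add_mul, mul_add, add_smul, smul_add]; abel)
    (fun c A B => by simp [smul_smul, mul_comm])

theorem fidelityOperator_apply (A B : Matrix (Fin d) (Fin d) ℂ) :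
    fidelityOperator A B = A.trace • B + B.trace • A + A * B + B * A :=
  rfl

theorem fidelityOperator_comm (A B : Matrix (Fin d) (Fin d) ℂ) :
    fidelityOperator A B = fidelityOperator B A := by
  simp only [fidelityOperator_apply]
  abel

open Finset in
theorem sum_permanent_fin_three_eq (A B C : Matrix (Fin d) (Fin d) ℂ) :
    ∑ a : Fin 3 → Fin d, (of fun i j => ![A, B, C] j (a i) (a j)).permanent
      = (A.trace * B.trace + (A * B).trace) * C.trace + (C * fidelityOperator A B).trace := by
  have hcycle : ∀ X Y Z : Matrix (Fin d) (Fin d) ℂ,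
      ∑ i, ∑ j, ∑ k, X i j * Y j k * Z k i = (X * Y * Z).trace := fun X Y Z => by
    simp only [trace, diag_apply, mul_apply, sum_mul]
    exact sum_congr rfl fun _ _ => sum_comm
  have htrace : ∀ X Y Z : Matrix (Fin d) (Fin d) ℂ,
      ∑ i, ∑ j, ∑ k, X i i * Y j k * Z k j = X.trace * (Y * Z).trace := fun X Y Z => by
    simp only [trace, diag_apply, mul_apply, mul_assoc, ← mul_sum, ← sum_mul]
  have hperm : ∀ i j k : Fin d,
      (of fun p q => ![A, B, C] q (![i, j, k] p) (![i, j, k] q)).permanent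
      = A i i * B j j * C k k + A i i * C j k * B k j + B i j * A j i * C k k
        + B i j * C j k * A k i + A j i * C i k * B k j + B j j * C i k * A k i :=
    fun i j k => permanent_fin_three _
  calc ∑ a : Fin 3 → Fin d, (of fun p q => ![A, B, C] q (a p) (a q)).permanent
      = A.trace * B.trace * C.trace + A.trace * (C * B).trace + (B * A).trace * C.trace
          + (B * C * A).trace + (A * C * B).trace + B.trace * (C * A).trace := by
        simp only [sum_fin_three_arrow, hperm, sum_add_distrib, hcycle, htrace]
        rw [sum_comm (f := fun i j => ∑ k, A j i * C i k * B k j), hcycle,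
          sum_comm (f := fun i j => ∑ k, B j j * C i k * A k i), htrace]
        simp only [trace, diag_apply, mul_apply, ← mul_sum, ← sum_mul]
    _ = (A.trace * B.trace + (A * B).trace) * C.trace + (C * fidelityOperator A B).trace := by
        simp only [fidelityOperator_apply, mul_add, trace_add, Matrix.mul_smul, trace_smul,
          smul_eq_mul, ← mul_assoc, trace_mul_comm B A, trace_mul_cycle C A B,
          trace_mul_cycle C B A]
        ring

theorem integral_trace_ketBra_mul_three [NeZero d] (A B C : Matrix (Fin d) (Fin d) ℂ) :
    ∫ ψ : PureState d, (ketBra ψ.1 * A).trace * (ketBra ψ.1 * B).trace * (ketBra ψ.1 * C).trace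
      ∂(haarPureState d)
    = ((A.trace * B.trace + (A * B).trace) * C.trace + (C * fidelityOperator A B).trace)
      / (d * (d + 1) * (d + 2)) := by
  obtain ⟨m, hm⟩ := exists_integral_prod_trace_ketBra_mul_eq (d := d) (Fin 3)
  have key : ∀ A B C : Matrix (Fin d) (Fin d) ℂ,
      ∫ ψ : PureState d, (ketBra ψ.1 * A).trace * (ketBra ψ.1 * B).trace *
        (ketBra ψ.1 * C).trace ∂(haarPureState d)
      = m * ((A.trace * B.trace + (A * B).trace) * C.trace
          + (C * fidelityOperator A B).trace) := by
    intro A B C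
    rw [← sum_permanent_fin_three_eq, ← hm]
    simp only [Fin.prod_univ_three, cons_val]
  have hm1 : m * (d * (d + 1) * (d + 2)) = 1 := by
    have hone := key 1 1 1
    simp only [mul_one, trace_ketBra_pureState, integral_const, probReal_univ, one_smul,
      fidelityOperator_apply, trace_one, trace_add, trace_smul, smul_eq_mul, Fintype.card_fin,
      one_mul] at hone
    linear_combination -hone
  rw [key, eq_div_iff (right_ne_zero_of_mul_eq_one hm1)]
  linear_combination ((A.trace * B.trace + (A * B).trace) * C.trace
    + (C * fidelityOperator A B).trace) * hm1

end TraceMoments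

section Fidelity

open MeasureTheory Matrix

theorem ofReal_re_trace_mul {n : Type*} [Fintype n] {A B : Matrix n n ℂ} (hA : A.IsHermitian)
    (hB : B.IsHermitian) : (((A * B).trace.re : ℝ) : ℂ) = (A * B).trace := by
  rw [← Complex.conj_eq_iff_re, starRingEnd_apply, ← trace_conjTranspose, conjTranspose_mul, hA.eq,
    hB.eq, trace_mul_comm]

variable {d : ℕ}

theorem posSemidef_ketBra (ψ : EuclideanSpace ℂ (Fin d)) : (ketBra ψ).PosSemidef :=
  posSemidef_vecMulVec_self_star _

theorem integral_re_trace_ketBra_kronecker_mul [NeZero d] {A B C : Matrix (Fin d) (Fin d) ℂ}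
    (hA : A.IsHermitian) (hB : B.IsHermitian) (hC : C.IsHermitian) :
    ∫ ψ : PureState d, ((ketBra ψ.1 ⊗ₖ ketBra ψ.1) * (A ⊗ₖ B)).trace.re *
        (ketBra ψ.1 * C).trace.re ∂(haarPureState d)
      = (((A.trace * B.trace + (A * B).trace) * C.trace).re
          + (C * fidelityOperator A B).trace.re) / (d * (d + 1) * (d + 2)) := by
  have hre : ∀ ψ : PureState d,
      ((ketBra ψ.1 ⊗ₖ ketBra ψ.1) * (A ⊗ₖ B)).trace.re * (ketBra ψ.1 * C).trace.re
      = RCLike.re ((ketBra ψ.1 * A).trace * (ketBra ψ.1 * B).trace * (ketBra ψ.1 * C).trace) := by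
    intro ψ
    have hψ := (posSemidef_ketBra ψ.1).isHermitian
    rw [← mul_kronecker_mul, trace_kronecker, ← ofReal_re_trace_mul hψ hA,
      ← ofReal_re_trace_mul hψ hB, ← ofReal_re_trace_mul hψ hC]
    simp only [← Complex.ofReal_mul, RCLike.re_eq_complex_re, Complex.ofReal_re]
  have hcast : (d : ℂ) * (d + 1) * (d + 2) = ((d * (d + 1) * (d + 2) : ℝ) : ℂ) := by
    push_cast
    rfl
  simp only [hre]
  rw [integral_re (integrable_of_continuous (by fun_prop)), integral_trace_ketBra_mul_three, hcast,
    RCLike.re_eq_complex_re, Complex.div_ofReal_re, Complex.add_re]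

namespace POVM

variable {ι κ : Type*} [Fintype ι] [Fintype κ]

/-- The estimator-dependent part `∑_{j,k} tr(ρ_{jk} Q(A_j, B_k))`, with `Q` the
`fidelityOperator`, of the two-copy average fidelity of `A ⊗ B` and the estimators `ρ_{jk}`. -/
noncomputable def fidelityScore (A : POVM ι (Fin d)) (B : POVM κ (Fin d))
    (est : ι × κ → DensityOperator d) : ℝ :=
  ∑ p, ((est p).mat * fidelityOperator (A.elem p.1) (B.elem p.2)).trace.re

theorem avgFidelity_prod [NeZero d] (A : POVM ι (Fin d)) (B : POVM κ (Fin d))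
    (est : ι × κ → DensityOperator d) :
    (A.prod B).avgFidelity est
      = ((d : ℝ) ^ 2 + d + A.fidelityScore B est) / (d * (d + 1) * (d + 2)) := by
  have htrace : ∑ p : ι × κ, ((A.elem p.1).trace * (B.elem p.2).trace
      + (A.elem p.1 * B.elem p.2).trace) = (d : ℂ) ^ 2 + d := by
    rw [Finset.sum_add_distrib, Fintype.sum_prod_type, Fintype.sum_prod_type]
    dsimp only
    simp only [← Finset.mul_sum, ← Finset.sum_mul, ← trace_sum, A.sum_elem, B.sum_elem, trace_one,
      mul_one, Fintype.card_fin, sq]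
  have hre : ∑ p : ι × κ, ((A.elem p.1).trace * (B.elem p.2).trace
      + (A.elem p.1 * B.elem p.2).trace).re = (d : ℝ) ^ 2 + d := by
    rw [← Complex.re_sum, htrace]
    norm_cast
  rw [fidelityScore, ← hre, ← Finset.sum_add_distrib, Finset.sum_div]
  refine Finset.sum_congr rfl fun p _ => ?_
  refine (integral_re_trace_ketBra_kronecker_mul (A.posSemidef p.1).isHermitian
    (B.posSemidef p.2).isHermitian (est p).posSemidef.isHermitian).trans ?_
  rw [(est p).trace_eq_one, mul_one]

end POVM

end Fidelity

section RankOne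

open Matrix

theorem norm_inner_sq_add_norm_inner_sq_le {𝕜 E : Type*} [RCLike 𝕜] [SeminormedAddCommGroup E]
    [InnerProductSpace 𝕜 E] {x y : E} (hx : ‖x‖ = 1) (hy : ‖y‖ = 1) (v : E) :
    ‖inner 𝕜 x v‖ ^ 2 + ‖inner 𝕜 y v‖ ^ 2 ≤ (1 + ‖inner 𝕜 x y‖) * ‖v‖ ^ 2 := by
  set p := inner 𝕜 x v with hp
  set q := inner 𝕜 y v with hq
  have hnorm : ‖p • x + q • y‖ ^ 2 ≤ (1 + ‖inner 𝕜 x y‖) * (‖p‖ ^ 2 + ‖q‖ ^ 2) := by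
    have hcross : RCLike.re (inner 𝕜 (p • x) (q • y)) ≤ ‖p‖ * ‖q‖ * ‖inner 𝕜 x y‖ := by
      refine (RCLike.re_le_norm _).trans_eq ?_
      rw [inner_smul_left, inner_smul_right, norm_mul, norm_mul, RCLike.norm_conj, mul_assoc]
    rw [norm_add_sq (𝕜 := 𝕜), norm_smul, norm_smul, hx, hy]
    nlinarith [mul_nonneg (norm_nonneg (inner 𝕜 x y)) (sq_nonneg (‖p‖ - ‖q‖))]
  have hinner : inner 𝕜 (p • x + q • y) v = ((‖p‖ ^ 2 + ‖q‖ ^ 2 : ℝ) : 𝕜) := by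
    rw [inner_add_left, inner_smul_left, inner_smul_left, ← hp, ← hq, RCLike.conj_mul,
      RCLike.conj_mul]
    push_cast
    rfl
  have hle : ‖p‖ ^ 2 + ‖q‖ ^ 2 ≤ ‖p • x + q • y‖ * ‖v‖ := by
    have hcs := norm_inner_le_norm (𝕜 := 𝕜) (p • x + q • y) v
    rwa [hinner, RCLike.norm_ofReal, abs_of_nonneg (by positivity)] at hcs
  rcases (by positivity : 0 ≤ ‖p‖ ^ 2 + ‖q‖ ^ 2).eq_or_lt with h | h
  · rw [← h]
    positivity
  · refine le_of_mul_le_mul_left ?_ h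
    calc (‖p‖ ^ 2 + ‖q‖ ^ 2) * (‖p‖ ^ 2 + ‖q‖ ^ 2)
        ≤ (‖p • x + q • y‖ * ‖v‖) * (‖p • x + q • y‖ * ‖v‖) := by gcongr
      _ = ‖p • x + q • y‖ ^ 2 * ‖v‖ ^ 2 := by ring
      _ ≤ (1 + ‖inner 𝕜 x y‖) * (‖p‖ ^ 2 + ‖q‖ ^ 2) * ‖v‖ ^ 2 := by gcongr
      _ = (‖p‖ ^ 2 + ‖q‖ ^ 2) * ((1 + ‖inner 𝕜 x y‖) * ‖v‖ ^ 2) := by ring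

variable {d : ℕ}

theorem ketBra_smul (c : ℂ) (u : EuclideanSpace ℂ (Fin d)) :
    ketBra (c • u) = ((‖c‖ : ℂ) ^ 2) • ketBra u := by
  ext a b
  simp only [ketBra, of_apply, PiLp.smul_apply, smul_eq_mul, star_mul', Matrix.smul_apply]
  rw [← Complex.mul_conj', starRingEnd_apply]
  ring

theorem trace_ketBra_mul_ketBra_mul_ketBra (u v w : EuclideanSpace ℂ (Fin d)) :
    (ketBra u * ketBra v * ketBra w).trace = inner ℂ u v * inner ℂ v w * inner ℂ w u := by
  simp only [ketBra_eq_vecMulVec, vecMulVec_mul_vecMulVec, trace_vecMulVec, dotProduct_smul,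
    EuclideanSpace.inner_eq_star_dotProduct, smul_eq_mul, dotProduct_comm]

theorem trace_ketBra_mul_ketBra (u v : EuclideanSpace ℂ (Fin d)) :
    (ketBra u * ketBra v).trace = (‖inner ℂ u v‖ : ℂ) ^ 2 := by
  rw [← Complex.mul_conj', inner_conj_symm]
  simp only [ketBra_eq_vecMulVec, vecMulVec_mul_vecMulVec, trace_vecMulVec, dotProduct_smul,
    EuclideanSpace.inner_eq_star_dotProduct, smul_eq_mul, dotProduct_comm]

theorem ketBra_eq_of_norm_inner_eq_one {x y : EuclideanSpace ℂ (Fin d)} (hx : ‖x‖ = 1)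
    (hy : ‖y‖ = 1) (h : ‖inner ℂ x y‖ = 1) : ketBra x = ketBra y := by
  have hx0 : x ≠ 0 := norm_ne_zero_iff.mp (by simp [hx])
  have hy0 : y ≠ 0 := norm_ne_zero_iff.mp (by simp [hy])
  obtain ⟨r, -, rfl⟩ := (norm_inner_eq_norm_iff hx0 hy0).mp (by rw [h, hx, hy, one_mul])
  have hr : ‖r‖ = 1 := by rwa [norm_smul, hx, mul_one] at hy
  rw [ketBra_smul, hr, Complex.ofReal_one, one_pow, one_smul]

theorem exists_ketBra_eq_and_inner_eq_norm (x y : EuclideanSpace ℂ (Fin d)) :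
    ∃ z, ketBra z = ketBra y ∧ ‖z‖ = ‖y‖ ∧ inner ℂ x z = ‖inner ℂ x y‖ := by
  obtain ⟨c, hc, h⟩ := RCLike.exists_norm_eq_mul_self (inner ℂ x y)
  refine ⟨c • y, ?_, ?_, ?_⟩
  · rw [ketBra_smul, hc, Complex.ofReal_one, one_pow, one_smul]
  · rw [norm_smul, hc, one_mul]
  · rw [inner_smul_right]
    exact h.symm

theorem re_trace_ketBra_mul_fidelityOperator_ketBra (x y v : EuclideanSpace ℂ (Fin d)) :
    (ketBra v * fidelityOperator (ketBra x) (ketBra y)).trace.re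
      = ‖x‖ ^ 2 * ‖inner ℂ y v‖ ^ 2 + ‖y‖ ^ 2 * ‖inner ℂ x v‖ ^ 2
        + 2 * (inner ℂ v x * inner ℂ x y * inner ℂ y v).re := by
  have hconj : (inner ℂ v y * inner ℂ y x * inner ℂ x v).re
      = (inner ℂ v x * inner ℂ x y * inner ℂ y v).re := by
    rw [← Complex.conj_re]
    simp only [map_mul, inner_conj_symm]
    ring_nf
  simp only [fidelityOperator_apply, mul_add, trace_add, Matrix.mul_smul, trace_smul, trace_ketBra,
    trace_ketBra_mul_ketBra, ← mul_assoc, trace_ketBra_mul_ketBra_mul_ketBra, Complex.add_re, hconj,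
    smul_eq_mul, norm_inner_symm v]
  norm_cast
  ring

theorem re_trace_ketBra_mul_fidelityOperator_ketBra_le {x y : EuclideanSpace ℂ (Fin d)}
    (hx : ‖x‖ = 1) (hy : ‖y‖ = 1) (v : EuclideanSpace ℂ (Fin d)) :
    (ketBra v * fidelityOperator (ketBra x) (ketBra y)).trace.re
      ≤ (1 + ‖inner ℂ x y‖) ^ 2 * ‖v‖ ^ 2 := by
  have hcross := Complex.re_le_norm (inner ℂ v x * inner ℂ x y * inner ℂ y v)
  rw [norm_mul, norm_mul, norm_inner_symm v x] at hcross
  have hsum := norm_inner_sq_add_norm_inner_sq_le (𝕜 := ℂ) hx hy v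
  rw [re_trace_ketBra_mul_fidelityOperator_ketBra, hx, hy]
  nlinarith [mul_nonneg (norm_nonneg (inner ℂ x y))
    (sq_nonneg (‖inner ℂ x v‖ - ‖inner ℂ y v‖)), norm_nonneg (inner ℂ x y)]

theorem exists_re_trace_ketBra_mul_fidelityOperator_ketBra_eq {x y : EuclideanSpace ℂ (Fin d)}
    (hx : ‖x‖ = 1) (hy : ‖y‖ = 1) :
    ∃ v : PureState d, (ketBra v.1 * fidelityOperator (ketBra x) (ketBra y)).trace.re
      = (1 + ‖inner ℂ x y‖) ^ 2 := by
  obtain ⟨z, hzy, hz, hxz⟩ := exists_ketBra_eq_and_inner_eq_norm x y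
  rw [hy] at hz
  rw [← hzy]
  generalize ‖inner ℂ x y‖ = c, norm_nonneg (inner ℂ x y) = hc at hxz ⊢
  have hzx : inner ℂ z x = (c : ℂ) := by rw [← inner_conj_symm, hxz, Complex.conj_ofReal]
  have hxu : inner ℂ x (x + z) = ((1 + c : ℝ) : ℂ) := by
    rw [inner_add_right, inner_self_eq_norm_sq_to_K, hx, hxz]
    simp
  have hzu : inner ℂ z (x + z) = ((1 + c : ℝ) : ℂ) := by
    rw [inner_add_right, inner_self_eq_norm_sq_to_K, hz, hzx]
    simp [add_comm]
  have hu : ‖x + z‖ ^ 2 = 2 * (1 + c) := by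
    rw [norm_add_sq (𝕜 := ℂ), hxz, hx, hz]
    simp only [RCLike.re_eq_complex_re, Complex.ofReal_re]
    ring
  have hu0 : ‖x + z‖ ≠ 0 := fun h => by
    rw [h] at hu
    linarith
  have hnorm : ‖((‖x + z‖⁻¹ : ℝ) : ℂ) • (x + z)‖ = 1 := by
    rw [norm_smul, Complex.norm_real, norm_inv, norm_norm, inv_mul_cancel₀ hu0]
  refine ⟨⟨_, mem_sphere_zero_iff_norm.mpr hnorm⟩, ?_⟩
  rw [ketBra_smul, smul_mul_assoc, trace_smul, smul_eq_mul, ← Complex.ofReal_pow,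
    Complex.re_ofReal_mul, re_trace_ketBra_mul_fidelityOperator_ketBra, ← inner_conj_symm _ x, hxu,
    hzu, hxz, hx, hz, Complex.conj_ofReal, ← Complex.ofReal_mul, ← Complex.ofReal_mul,
    Complex.ofReal_re, Complex.norm_real, Complex.norm_real, Real.norm_eq_abs, Real.norm_eq_abs,
    sq_abs, sq_abs, inv_pow, hu]
  field_simp
  ring

theorem ketBra_eq_of_re_trace_mul_fidelityOperator_self {x : EuclideanSpace ℂ (Fin d)}
    (hx : ‖x‖ = 1) (v : PureState d)
    (h : (ketBra v.1 * fidelityOperator (ketBra x) (ketBra x)).trace.re = 4) :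
    ketBra v.1 = ketBra x := by
  rw [re_trace_ketBra_mul_fidelityOperator_ketBra, inner_self_eq_norm_sq_to_K, hx,
    RCLike.ofReal_one, one_pow, one_pow, mul_one, ← inner_conj_symm v.1, Complex.conj_mul',
    ← Complex.ofReal_pow, Complex.ofReal_re] at h
  refine (ketBra_eq_of_norm_inner_eq_one hx (by simp) ?_).symm
  nlinarith [norm_nonneg (inner ℂ x v.1)]

theorem re_trace_ketBra_mul_fidelityOperator_ketBra_left {x y : EuclideanSpace ℂ (Fin d)}
    (hx : ‖x‖ = 1) (hy : ‖y‖ = 1) :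
    (ketBra x * fidelityOperator (ketBra x) (ketBra y)).trace.re
      = 1 + 3 * ‖inner ℂ x y‖ ^ 2 := by
  rw [re_trace_ketBra_mul_fidelityOperator_ketBra, inner_self_eq_norm_sq_to_K, hx, hy,
    RCLike.ofReal_one, one_pow, one_pow, one_mul, one_mul, one_mul, ← inner_conj_symm y x,
    Complex.mul_conj', ← Complex.ofReal_pow, Complex.ofReal_re, RCLike.norm_conj, norm_one]
  ring

theorem exists_eq_sum_ketBra {M : Matrix (Fin d) (Fin d) ℂ} (hM : M.PosSemidef) :
    ∃ (m : ℕ) (u : Fin m → EuclideanSpace ℂ (Fin d)), M = ∑ i, ketBra (u i) := by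
  obtain ⟨m, u, hu⟩ := posSemidef_iff_eq_sum_vecMulVec.mp hM
  exact ⟨m, fun i => WithLp.toLp 2 (u i), hu⟩

theorem re_trace_ketBra_mul_le {M : Matrix (Fin d) (Fin d) ℂ} {K : ℝ}
    (hK : ∀ v : PureState d, (ketBra v.1 * M).trace.re ≤ K) (u : EuclideanSpace ℂ (Fin d)) :
    (ketBra u * M).trace.re ≤ ‖u‖ ^ 2 * K := by
  rcases eq_or_ne u 0 with rfl | hu
  · have hzero : ketBra (0 : EuclideanSpace ℂ (Fin d)) = 0 := by
      ext
      simp [ketBra]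
    simp [hzero]
  · have hu0 : (‖u‖ : ℂ) ≠ 0 := by simpa using hu
    calc (ketBra u * M).trace.re
        = ‖u‖ ^ 2 * (ketBra ((‖u‖ : ℂ)⁻¹ • u) * M).trace.re := by
          conv_lhs => rw [← smul_inv_smul₀ hu0 u, ketBra_smul, smul_mul_assoc, trace_smul,
            smul_eq_mul, Complex.norm_real, norm_norm, ← Complex.ofReal_pow, Complex.re_ofReal_mul]
      _ ≤ ‖u‖ ^ 2 * K := by
          gcongr
          exact hK ⟨(‖u‖ : ℂ)⁻¹ • u, by simp [norm_smul, hu]⟩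

theorem DensityOperator.re_trace_mul_le {M : Matrix (Fin d) (Fin d) ℂ} {K : ℝ}
    (hK : ∀ v : PureState d, (ketBra v.1 * M).trace.re ≤ K) (ρ : DensityOperator d) :
    (ρ.mat * M).trace.re ≤ K := by
  obtain ⟨m, u, hu⟩ := exists_eq_sum_ketBra ρ.posSemidef
  have hnorm : ∑ i, ‖u i‖ ^ 2 = 1 := by
    have htrace := ρ.trace_eq_one
    rw [hu, trace_sum] at htrace
    simp only [trace_ketBra] at htrace
    exact_mod_cast htrace
  calc (ρ.mat * M).trace.re = ∑ i, (ketBra (u i) * M).trace.re := by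
        rw [hu, Finset.sum_mul, trace_sum, Complex.re_sum]
    _ ≤ ∑ i, ‖u i‖ ^ 2 * K := Finset.sum_le_sum fun i _ => re_trace_ketBra_mul_le hK (u i)
    _ = K := by rw [← Finset.sum_mul, hnorm, one_mul]

theorem DensityOperator.re_trace_mul_fidelityOperator_ketBra_le (ρ : DensityOperator d)
    {x y : EuclideanSpace ℂ (Fin d)} (hx : ‖x‖ = 1) (hy : ‖y‖ = 1) :
    (ρ.mat * fidelityOperator (ketBra x) (ketBra y)).trace.re ≤ (1 + ‖inner ℂ x y‖) ^ 2 :=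
  ρ.re_trace_mul_le fun v => by
    simpa using re_trace_ketBra_mul_fidelityOperator_ketBra_le hx hy v.1

/-- The pure state `|v⟩⟨v|` regarded as an estimator. -/
def PureState.toDensityOperator (v : PureState d) : DensityOperator d where
  mat := ketBra v.1
  posSemidef := posSemidef_ketBra v.1
  trace_eq_one := trace_ketBra_pureState v

end RankOne

section OptimalEstimators

variable {ι κ : Type*} [Fintype ι] [Fintype κ] {d : ℕ}

theorem exists_pureState_forall_re_trace_mul_le [NeZero d] (M : Matrix (Fin d) (Fin d) ℂ) :
    ∃ v : PureState d, ∀ ρ : DensityOperator d,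
      (ρ.mat * M).trace.re ≤ (ketBra v.1 * M).trace.re := by
  have hcont : Continuous fun v : PureState d => (ketBra v.1 * M).trace.re := by fun_prop
  have hne : Nonempty (PureState d) := ⟨⟨EuclideanSpace.single 0 1, by simp⟩⟩
  obtain ⟨v, -, hv⟩ := isCompact_univ.exists_isMaxOn Set.univ_nonempty hcont.continuousOn
  exact ⟨v, fun ρ => ρ.re_trace_mul_le fun w => hv (Set.mem_univ w)⟩

namespace POVM

theorem exists_isGreatest_avgFidelity_prod [NeZero d] (A : POVM ι (Fin d)) (B : POVM κ (Fin d)) :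
    ∃ v : ι × κ → PureState d, IsGreatest (Set.range (A.prod B).avgFidelity)
      ((A.prod B).avgFidelity fun p => (v p).toDensityOperator) := by
  choose v hv using fun p : ι × κ =>
    exists_pureState_forall_re_trace_mul_le (fidelityOperator (A.elem p.1) (B.elem p.2))
  refine ⟨v, ⟨_, rfl⟩, ?_⟩
  rintro _ ⟨est, rfl⟩
  rw [avgFidelity_prod, avgFidelity_prod]
  gcongr
  exact Finset.sum_le_sum fun p _ => hv p (est p)

theorem avgFidelity_prod_le_estimationFidelity [NeZero d] (A : POVM ι (Fin d)) (B : POVM κ (Fin d))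
    (est : ι × κ → DensityOperator d) :
    (A.prod B).avgFidelity est ≤ (A.prod B).estimationFidelity :=
  have ⟨_, hv⟩ := A.exists_isGreatest_avgFidelity_prod B
  le_ciSup hv.bddAbove est

theorem exists_avgFidelity_prod_eq_estimationFidelity [NeZero d] (A : POVM ι (Fin d))
    (B : POVM κ (Fin d)) :
    ∃ v : ι × κ → PureState d,
      (A.prod B).avgFidelity (fun p => (v p).toDensityOperator) = (A.prod B).estimationFidelity :=
  have ⟨v, hv⟩ := A.exists_isGreatest_avgFidelity_prod B
  ⟨v, hv.csSup_eq.symm⟩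

end POVM

end OptimalEstimators

section WelchBound

open Matrix

theorem re_trace_mul_sq_le {n : Type*} [Fintype n] {A B : Matrix n n ℂ}
    (hA : A.IsHermitian) (hB : B.IsHermitian) :
    (A * B).trace.re ^ 2 ≤ (A * A).trace.re * (B * B).trace.re := by
  have hquad : ∀ t : ℝ, 0 ≤ (A * A).trace.re * (t * t) + 2 * (A * B).trace.re * t
      + (B * B).trace.re := by
    intro t
    have hherm : ((t : ℂ) • A + B)ᴴ = (t : ℂ) • A + B := by
      rw [conjTranspose_add, conjTranspose_smul, hA.eq, hB.eq, Complex.star_def,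
        Complex.conj_ofReal]
    have hnonneg := (posSemidef_conjTranspose_mul_self ((t : ℂ) • A + B)).trace_nonneg
    rw [hherm] at hnonneg
    refine (Complex.le_def.mp hnonneg).1.trans_eq ?_
    simp only [add_mul, mul_add, smul_mul_assoc, Matrix.mul_smul, trace_add, trace_smul,
      trace_mul_comm B A, smul_eq_mul, Complex.add_re, Complex.re_ofReal_mul]
    ring
  have hdiscrim := discrim_le_zero hquad
  rw [discrim] at hdiscrim
  linarith

variable {n : Type*} [DecidableEq n]

variable (n) in
/-- The swap operator `e_i ⊗ e_j ↦ e_j ⊗ e_i`; on `1 + swapMatrix n`, twice the projector onto the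
symmetric subspace, the Welch bound is a Cauchy–Schwarz inequality. -/
def swapMatrix : Matrix (n × n) (n × n) ℂ :=
  Equiv.Perm.permMatrix ℂ (Equiv.prodComm n n)

theorem isHermitian_swapMatrix : (swapMatrix n).IsHermitian :=
  conjTranspose_permMatrix _

variable [Fintype n]

theorem swapMatrix_mul_self : swapMatrix n * swapMatrix n = 1 :=
  (permMatrix_mul _ _).symm.trans permMatrix_one

theorem trace_kronecker_mul_swapMatrix (A B : Matrix n n ℂ) :
    ((A ⊗ₖ B) * swapMatrix n).trace = (A * B).trace := by
  simp [trace, mul_apply, Fintype.sum_prod_type, swapMatrix, PEquiv.toMatrix_apply,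
    Equiv.toPEquiv_apply, ite_and]

theorem trace_one_add_swapMatrix_mul_self :
    ((1 + swapMatrix n) * (1 + swapMatrix n)).trace
      = 2 * (Fintype.card n * (Fintype.card n + 1)) := by
  have htrace : (swapMatrix n).trace = Fintype.card n := by
    have h := trace_kronecker_mul_swapMatrix (1 : Matrix n n ℂ) 1
    rwa [one_kronecker_one, one_mul, one_mul, trace_one] at h
  simp only [add_mul, mul_add, one_mul, mul_one, swapMatrix_mul_self, trace_add, trace_one, htrace,
    Fintype.card_prod, Nat.cast_mul]
  ring

theorem welch_bound_two {R : Type*} [Fintype R] {d : ℕ} (w : R → ℝ)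
    (x : R → EuclideanSpace ℂ (Fin d)) :
    2 * (∑ r, w r * ‖x r‖ ^ 4) ^ 2
      ≤ d * (d + 1) * ∑ r, ∑ s, w r * w s * ‖inner ℂ (x r) (x s)‖ ^ 4 := by
  set G := ∑ r, (w r : ℂ) • (ketBra (x r) ⊗ₖ ketBra (x r)) with hG
  have hGG : (G * G).trace = ((∑ r, ∑ s, w r * w s * ‖inner ℂ (x r) (x s)‖ ^ 4 : ℝ) : ℂ) := by
    simp only [hG, Finset.sum_mul_sum, trace_sum, smul_mul_smul_comm, trace_smul,
      ← mul_kronecker_mul, trace_kronecker, trace_ketBra_mul_ketBra, smul_eq_mul]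
    push_cast
    ring_nf
  have hGP : (G * (1 + swapMatrix (Fin d))).trace = ((2 * ∑ r, w r * ‖x r‖ ^ 4 : ℝ) : ℂ) := by
    simp only [hG, mul_add, mul_one, Finset.sum_mul, trace_add, trace_sum, smul_mul_assoc,
      trace_smul, trace_kronecker_mul_swapMatrix, trace_kronecker, trace_ketBra,
      trace_ketBra_mul_ketBra, inner_self_eq_norm_sq_to_K, norm_pow, RCLike.norm_ofReal, abs_norm,
      smul_eq_mul]
    push_cast
    ring_nf
  have hGH : G.IsHermitian := isSelfAdjoint_sum _ fun r _ =>
    ((posSemidef_ketBra _).kronecker (posSemidef_ketBra _)).isHermitian.smul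
      (Complex.conj_ofReal _)
  have hcs := re_trace_mul_sq_le hGH (isHermitian_one.add isHermitian_swapMatrix)
  have hcast : (2 * (d * (d + 1)) : ℂ) = ((2 * (d * (d + 1)) : ℝ) : ℂ) := by
    push_cast
    rfl
  rw [hGG, hGP, trace_one_add_swapMatrix_mul_self, Fintype.card_fin, hcast, Complex.ofReal_re,
    Complex.ofReal_re, Complex.ofReal_re] at hcs
  linarith

end WelchBound

section TangentQuartic

/-- The even quartic in `x` that touches the line `2 c (1 + c)² x` at `x = c` and meets it again at
`x = 1`. Averaged over the overlaps of a rank-one POVM, it turns the moments of order `0`, `2` and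
`4` into a bound on the moment of order `1`. -/
def tangentQuartic (c x : ℝ) : ℝ :=
  c ^ 2 * (1 + 2 * c) + (1 + 2 * c + 3 * c ^ 2) * x ^ 2 - x ^ 4

theorem tangentQuartic_sub (c x : ℝ) :
    tangentQuartic c x - 2 * c * (1 + c) ^ 2 * x = (1 - x) * (x - c) ^ 2 * (x + 1 + 2 * c) := by
  rw [tangentQuartic]
  ring

variable {c x : ℝ}

theorem le_tangentQuartic (hc : 0 ≤ c) (hx0 : 0 ≤ x) (hx1 : x ≤ 1) :
    2 * c * (1 + c) ^ 2 * x ≤ tangentQuartic c x := by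
  rw [← sub_nonneg, tangentQuartic_sub]
  exact mul_nonneg (mul_nonneg (sub_nonneg.mpr hx1) (sq_nonneg _)) (by positivity)

theorem eq_one_or_eq_of_eq_tangentQuartic (hc : 0 ≤ c) (hx : 0 ≤ x)
    (h : 2 * c * (1 + c) ^ 2 * x = tangentQuartic c x) : x = 1 ∨ x = c := by
  have hpos : x + 1 + 2 * c ≠ 0 := by positivity
  rw [eq_comm, ← sub_eq_zero, tangentQuartic_sub] at h
  rcases mul_eq_zero.mp ((mul_eq_zero.mp h).resolve_right hpos) with h1 | hxc
  · exact Or.inl (by linarith)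
  · exact Or.inr (sub_eq_zero.mp (pow_eq_zero_iff two_ne_zero |>.mp hxc))

end TangentQuartic

/-- The common modulus `1 / √(d + 1)` of the inner products of distinct vectors of a SIC. -/
noncomputable def sicOverlap (d : ℕ) : ℝ :=
  (√(d + 1))⁻¹

theorem sicOverlap_pos (d : ℕ) : 0 < sicOverlap d := by
  rw [sicOverlap]
  positivity

theorem sicOverlap_sq (d : ℕ) : sicOverlap d ^ 2 = 1 / ((d : ℝ) + 1) := by
  rw [sicOverlap, inv_pow, Real.sq_sqrt (by positivity), one_div]

theorem F2iid_eq (d : ℕ) :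
    F2iid d = ((d : ℝ) ^ 2 + d + ((d : ℝ) ^ 2 + d + 2 * (1 + ((d : ℝ) ^ 2 - 1) * sicOverlap d)))
      / (d * (d + 1) * (d + 2)) := by
  have hsqrt : ((d : ℝ) + 1) * sicOverlap d = √(d + 1) := by
    rw [sicOverlap, ← div_eq_mul_inv, Real.div_sqrt]
  rw [F2iid, ← hsqrt]
  ring_nf

/-- A POVM whose elements are positive multiples of rank-one projectors, with a choice of unit
vectors spanning them. -/
structure RankOnePOVM (R : Type*) [Fintype R] (d : ℕ) where
  weight : R → ℝ
  vec : R → EuclideanSpace ℂ (Fin d)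
  weight_pos : ∀ r, 0 < weight r
  norm_vec : ∀ r, ‖vec r‖ = 1
  sum_eq_one : ∑ r, (weight r : ℂ) • ketBra (vec r) = 1

namespace RankOnePOVM

open Matrix

variable {R : Type*} [Fintype R] {d : ℕ} (C : RankOnePOVM R d)

/-- The underlying POVM of a rank-one POVM. -/
def toPOVM : POVM R (Fin d) where
  elem r := (C.weight r : ℂ) • ketBra (C.vec r)
  posSemidef r := (posSemidef_ketBra _).smul (by exact_mod_cast (C.weight_pos r).le)
  sum_elem := C.sum_eq_one

/-- The modulus of the inner product of two of the vectors of a rank-one POVM. -/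
noncomputable def overlap (r s : R) : ℝ :=
  ‖inner ℂ (C.vec r) (C.vec s)‖

theorem overlap_nonneg (r s : R) : 0 ≤ C.overlap r s :=
  norm_nonneg _

theorem overlap_le_one (r s : R) : C.overlap r s ≤ 1 := by
  simpa [overlap, C.norm_vec] using norm_inner_le_norm (𝕜 := ℂ) (C.vec r) (C.vec s)

theorem overlap_self (r : R) : C.overlap r r = 1 := by
  simp [overlap, C.norm_vec]

theorem ketBra_vec_eq_of_overlap_eq_one {r s : R} (h : C.overlap r s = 1) :
    ketBra (C.vec r) = ketBra (C.vec s) :=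
  ketBra_eq_of_norm_inner_eq_one (C.norm_vec r) (C.norm_vec s) h

theorem trace_ketBra_vec (r : R) : (ketBra (C.vec r)).trace = 1 := by
  simp [trace_ketBra, C.norm_vec]

theorem sum_weight : ∑ r, C.weight r = d := by
  have h := congrArg trace C.sum_eq_one
  simp only [trace_sum, trace_smul, trace_ketBra_vec, trace_one, Fintype.card_fin, smul_eq_mul,
    mul_one] at h
  exact_mod_cast h

theorem sum_weight_mul_overlap_sq (r : R) : ∑ s, C.weight s * C.overlap r s ^ 2 = 1 := by
  have h := congrArg (fun M => (ketBra (C.vec r) * M).trace) C.sum_eq_one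
  simp only [Finset.mul_sum, trace_sum, Matrix.mul_smul, trace_smul, trace_ketBra_mul_ketBra,
    mul_one, trace_ketBra_vec, smul_eq_mul] at h
  exact_mod_cast h

/-- The moment of order `k` of the overlaps of a rank-one POVM with respect to the weights; for
`k = 4` this is the frame potential. -/
noncomputable def overlapMoment (k : ℕ) : ℝ :=
  ∑ p : R × R, C.weight p.1 * C.weight p.2 * C.overlap p.1 p.2 ^ k

theorem overlapMoment_zero : C.overlapMoment 0 = (d : ℝ) ^ 2 := by
  simp only [overlapMoment, pow_zero, mul_one, Fintype.sum_prod_type, ← Finset.mul_sum,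
    ← Finset.sum_mul, C.sum_weight, sq]

theorem overlapMoment_two : C.overlapMoment 2 = d := by
  simp only [overlapMoment, Fintype.sum_prod_type, mul_assoc, ← Finset.mul_sum,
    C.sum_weight_mul_overlap_sq, mul_one, C.sum_weight]

theorem two_mul_sicOverlap_sq_le_overlapMoment_four [NeZero d] :
    2 * d * sicOverlap d ^ 2 ≤ C.overlapMoment 4 := by
  have hd : (0 : ℝ) < d := Nat.cast_pos.mpr (NeZero.pos d)
  have hwelch := welch_bound_two C.weight C.vec
  simp only [C.norm_vec, one_pow, mul_one, C.sum_weight] at hwelch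
  rw [sicOverlap_sq, overlapMoment, Fintype.sum_prod_type, mul_one_div, div_le_iff₀ (by positivity)]
  refine le_of_mul_le_mul_left ?_ hd
  calc (d : ℝ) * (2 * d) = 2 * d ^ 2 := by ring
    _ ≤ _ := hwelch
    _ = _ := by
      simp only [overlap]
      ring

theorem sum_weight_mul_tangentQuartic (c : ℝ) :
    ∑ p : R × R, C.weight p.1 * C.weight p.2 * tangentQuartic c (C.overlap p.1 p.2)
      = c ^ 2 * (1 + 2 * c) * d ^ 2 + (1 + 2 * c + 3 * c ^ 2) * d - C.overlapMoment 4 := by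
  rw [← C.overlapMoment_zero, ← C.overlapMoment_two]
  simp only [overlapMoment, tangentQuartic, Finset.mul_sum, ← Finset.sum_add_distrib,
    ← Finset.sum_sub_distrib]
  exact Finset.sum_congr rfl fun p _ => by ring

theorem sum_weight_mul_tangentQuartic_sicOverlap_le [NeZero d] :
    ∑ p : R × R, C.weight p.1 * C.weight p.2 * tangentQuartic (sicOverlap d) (C.overlap p.1 p.2)
      ≤ 2 * sicOverlap d * (1 + sicOverlap d) ^ 2 * (1 + ((d : ℝ) ^ 2 - 1) * sicOverlap d) := by
  have hfour := C.two_mul_sicOverlap_sq_le_overlapMoment_four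
  have hsq : (d : ℝ) * sicOverlap d ^ 2 = 1 - sicOverlap d ^ 2 := by
    rw [sicOverlap_sq]
    field_simp
    ring
  rw [sum_weight_mul_tangentQuartic]
  set c := sicOverlap d
  refine (sub_le_sub_left hfour _).trans_eq ?_
  linear_combination ((d - 1) * (1 + 2 * c - 2 * (1 + c) ^ 2) - 1) * hsq

theorem weight_mul_overlap_le_weight_mul_tangentQuartic (p : R × R) :
    C.weight p.1 * C.weight p.2 * (2 * sicOverlap d * (1 + sicOverlap d) ^ 2 * C.overlap p.1 p.2)
      ≤ C.weight p.1 * C.weight p.2 * tangentQuartic (sicOverlap d) (C.overlap p.1 p.2) :=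
  mul_le_mul_of_nonneg_left
    (le_tangentQuartic (sicOverlap_pos d).le (C.overlap_nonneg _ _) (C.overlap_le_one _ _))
    (mul_pos (C.weight_pos _) (C.weight_pos _)).le

theorem mul_overlapMoment_one (K : ℝ) :
    K * C.overlapMoment 1 = ∑ p : R × R, C.weight p.1 * C.weight p.2 * (K * C.overlap p.1 p.2) := by
  rw [overlapMoment, Finset.mul_sum]
  exact Finset.sum_congr rfl fun p _ => by ring

theorem overlapMoment_one_le [NeZero d] :
    C.overlapMoment 1 ≤ 1 + ((d : ℝ) ^ 2 - 1) * sicOverlap d := by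
  have hc := sicOverlap_pos d
  refine le_of_mul_le_mul_left ?_ (by positivity : 0 < 2 * sicOverlap d * (1 + sicOverlap d) ^ 2)
  rw [mul_overlapMoment_one]
  exact (Finset.sum_le_sum fun p _ => C.weight_mul_overlap_le_weight_mul_tangentQuartic p).trans
    C.sum_weight_mul_tangentQuartic_sicOverlap_le

theorem overlap_eq_one_or_eq_sicOverlap [NeZero d]
    (h : C.overlapMoment 1 = 1 + ((d : ℝ) ^ 2 - 1) * sicOverlap d) (r s : R) :
    C.overlap r s = 1 ∨ C.overlap r s = sicOverlap d := by
  have hterm := fun (p : R × R) (_ : p ∈ Finset.univ) =>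
    C.weight_mul_overlap_le_weight_mul_tangentQuartic p
  have hle := C.sum_weight_mul_tangentQuartic_sicOverlap_le
  rw [← h, mul_overlapMoment_one] at hle
  have heq := (Finset.sum_eq_sum_iff_of_le hterm).mp ((Finset.sum_le_sum hterm).antisymm hle) (r, s)
    (Finset.mem_univ _)
  exact eq_one_or_eq_of_eq_tangentQuartic (sicOverlap_pos d).le (C.overlap_nonneg r s)
    (mul_left_cancel₀ (mul_pos (C.weight_pos r) (C.weight_pos s)).ne' heq)

theorem sum_weight_mul_one_add_overlap_sq :
    ∑ p : R × R, C.weight p.1 * C.weight p.2 * (1 + C.overlap p.1 p.2) ^ 2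
      = (d : ℝ) ^ 2 + d + 2 * C.overlapMoment 1 := by
  rw [← C.overlapMoment_zero, ← C.overlapMoment_two]
  simp only [overlapMoment, Finset.mul_sum, ← Finset.sum_add_distrib]
  exact Finset.sum_congr rfl fun p _ => by ring

end RankOnePOVM

section CoarseGraining

/-- `A` is the coarse graining of `C` by the stochastic matrix `K`. This is the matrix hidden in
`POVM.IsCoarseGraining`; the equality case depends on its support. -/
structure POVM.IsCoarseGrainingBy {ι R n : Type*} [Fintype ι] [Fintype R] [Fintype n]
    [DecidableEq n] (A : POVM ι n) (C : POVM R n) (K : ι → R → ℝ) : Prop where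
  nonneg : ∀ j r, 0 ≤ K j r
  sum_eq_one : ∀ r, ∑ j, K j r = 1
  elem_eq : ∀ j, A.elem j = ∑ r, (K j r : ℂ) • C.elem r

namespace POVM

variable {ι κ R n : Type*} [Fintype ι] [Fintype κ] [Fintype R] [Fintype n] [DecidableEq n]
  {A : POVM ι n} {B : POVM κ n} {C : POVM R n} {K : ι → R → ℝ} {L : κ → R → ℝ}

theorem isCoarseGraining_iff_exists_isCoarseGrainingBy :
    A.IsCoarseGraining C ↔ ∃ K : ι → R → ℝ, A.IsCoarseGrainingBy C K :=
  ⟨fun ⟨K, h0, h1, h⟩ => ⟨K, h0, h1, h⟩, fun ⟨K, h0, h1, h⟩ => ⟨K, h0, h1, h⟩⟩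

theorem IsCoarseGrainingBy.exists_pos (h : A.IsCoarseGrainingBy C K) (r : R) : ∃ j, 0 < K j r := by
  obtain ⟨j, -, hj⟩ : ∃ j ∈ Finset.univ, 0 < K j r := by
    apply Finset.exists_lt_of_sum_lt
    simp [h.sum_eq_one]
  exact ⟨j, hj⟩

theorem IsCoarseGrainingBy.sum_mul_mul (hA : A.IsCoarseGrainingBy C K)
    (hB : B.IsCoarseGrainingBy C L) (g : R × R → ℝ) :
    ∑ x : (ι × κ) × R × R, K x.1.1 x.2.1 * L x.1.2 x.2.2 * g x.2 = ∑ q, g q := by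
  rw [Fintype.sum_prod_type_right]
  refine Finset.sum_congr rfl fun q _ => ?_
  simp only [← Finset.sum_mul, Fintype.sum_prod_type, ← Finset.mul_sum, hA.sum_eq_one,
    hB.sum_eq_one, one_mul]

theorem IsCoarseGraining.trans (hAB : A.IsCoarseGraining B) (hBC : B.IsCoarseGraining C) :
    A.IsCoarseGraining C := by
  obtain ⟨K, hK0, hK1, hK⟩ := hAB
  obtain ⟨L, hL0, hL1, hL⟩ := hBC
  refine ⟨fun j r => ∑ k, K j k * L k r,
    fun j r => Finset.sum_nonneg fun k _ => mul_nonneg (hK0 j k) (hL0 k r), fun r => ?_,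
    fun j => ?_⟩
  · rw [Finset.sum_comm]
    simp only [← Finset.sum_mul, hK1, one_mul, hL1]
  · simp only [hK, hL, Finset.smul_sum, smul_smul, Complex.ofReal_sum, Complex.ofReal_mul,
      Finset.sum_smul]
    exact Finset.sum_comm

end POVM

end CoarseGraining

section RankOneRefinement

variable {d : ℕ}

theorem norm_sq_smul_ketBra_inv_norm_smul {u : EuclideanSpace ℂ (Fin d)} (hu : u ≠ 0) :
    ((‖u‖ ^ 2 : ℝ) : ℂ) • ketBra (((‖u‖⁻¹ : ℝ) : ℂ) • u) = ketBra u := by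
  have hu' := norm_ne_zero_iff.mpr hu
  rw [ketBra_smul, smul_smul, ← Complex.ofReal_pow, ← Complex.ofReal_mul, Complex.norm_real,
    norm_inv, norm_norm, inv_pow, mul_inv_cancel₀ (pow_ne_zero _ hu'), Complex.ofReal_one, one_smul]

open scoped Classical in
theorem sum_ne_zero_smul_ketBra {S : Type*} [Fintype S] (u : S → EuclideanSpace ℂ (Fin d))
    (f : S → ℂ) :
    ∑ s : {s // u s ≠ 0}, f s • ketBra (u s) = ∑ s, f s • ketBra (u s) := by
  refine Fintype.sum_of_injective _ Subtype.val_injective _ _ (fun s hs => ?_) fun _ => rfl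
  have hu : u s = 0 := by simpa using hs
  rw [hu, ← zero_smul ℂ (0 : EuclideanSpace ℂ (Fin d)), ketBra_smul]
  simp

open scoped Classical in
/-- The rank-one POVM of a family of vectors that resolves the identity: the vectors are
normalized, and those that vanish are discarded. -/
noncomputable def RankOnePOVM.ofVectors {S : Type*} [Fintype S]
    (u : S → EuclideanSpace ℂ (Fin d)) (hu : ∑ s, ketBra (u s) = 1) :
    RankOnePOVM {s // u s ≠ 0} d where
  weight s := ‖u s‖ ^ 2
  vec s := ((‖u s‖⁻¹ : ℝ) : ℂ) • u s
  weight_pos s := pow_pos (norm_pos_iff.mpr s.2) 2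
  norm_vec s := by
    rw [norm_smul, Complex.norm_real, norm_inv, norm_norm,
      inv_mul_cancel₀ (norm_ne_zero_iff.mpr s.2)]
  sum_eq_one := by
    rw [Finset.sum_congr rfl fun s _ => norm_sq_smul_ketBra_inv_norm_smul s.2]
    simpa [hu] using sum_ne_zero_smul_ketBra u 1

theorem RankOnePOVM.elem_toPOVM_ofVectors {S : Type*} [Fintype S]
    (u : S → EuclideanSpace ℂ (Fin d)) (hu : ∑ s, ketBra (u s) = 1) (s : {s // u s ≠ 0}) :
    (ofVectors u hu).toPOVM.elem s = ketBra (u s) :=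
  norm_sq_smul_ketBra_inv_norm_smul s.2

theorem POVM.exists_isCoarseGraining_rankOnePOVM.{u} {ι : Type u} [Fintype ι]
    (A : POVM ι (Fin d)) :
    ∃ (R : Type u) (_ : Fintype R) (C : RankOnePOVM R d), A.IsCoarseGraining C.toPOVM := by
  classical
  choose m u hu using fun j => exists_eq_sum_ketBra (A.posSemidef j)
  let u' : (Σ j, Fin (m j)) → EuclideanSpace ℂ (Fin d) := fun s => u s.1 s.2
  have hsum : ∀ f : ι → ℂ, ∑ s, f s.1 • ketBra (u' s) = ∑ j, f j • A.elem j := fun f => by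
    simp only [Fintype.sum_sigma, hu, Finset.smul_sum, u']
  have hone : ∑ s, ketBra (u' s) = 1 := by
    simpa [A.sum_elem] using hsum 1
  refine ⟨_, inferInstance, RankOnePOVM.ofVectors u' hone, fun j s => if s.1.1 = j then 1 else 0,
    fun j s => ite_nonneg zero_le_one le_rfl, fun s => by simp, fun j => ?_⟩
  have hj := (sum_ne_zero_smul_ketBra u' fun s => if s.1 = j then 1 else 0).trans
    (hsum fun i => if i = j then 1 else 0)
  simp only [RankOnePOVM.elem_toPOVM_ofVectors]
  simpa using hj.symm

theorem POVM.Compatible.exists_rankOnePOVM {ι κ : Type*} [Fintype ι] [Fintype κ]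
    {A : POVM ι (Fin d)} {B : POVM κ (Fin d)} (h : A.Compatible B) :
    ∃ (R : Type) (_ : Fintype R) (C : RankOnePOVM R d) (K : ι → R → ℝ) (L : κ → R → ℝ),
      A.IsCoarseGrainingBy C.toPOVM K ∧ B.IsCoarseGrainingBy C.toPOVM L := by
  obtain ⟨r, C, hA, hB⟩ := h
  obtain ⟨R, hR, D, hD⟩ := C.exists_isCoarseGraining_rankOnePOVM
  obtain ⟨K, hK⟩ := isCoarseGraining_iff_exists_isCoarseGrainingBy.mp (hA.trans hD)
  obtain ⟨L, hL⟩ := isCoarseGraining_iff_exists_isCoarseGrainingBy.mp (hB.trans hD)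
  exact ⟨R, hR, D, K, L, hK, hL⟩

end RankOneRefinement

namespace RankOnePOVM

variable {ι κ R : Type*} [Fintype R] {d : ℕ}

/-- The estimators `v` attain the best possible fidelity for every pair of outcomes `r`, `s` of the
rank-one POVM `C` that the stochastic matrices `K` and `L` send to the outcomes `j`, `k` with
positive probability. -/
def IsSaturatedBy (C : RankOnePOVM R d) (K : ι → R → ℝ) (L : κ → R → ℝ)
    (v : ι × κ → DensityOperator d) : Prop :=
  ∀ ⦃j k r s⦄, 0 < K j r → 0 < L k s →
    ((v (j, k)).mat * fidelityOperator (ketBra (C.vec r)) (ketBra (C.vec s))).trace.re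
      = (1 + C.overlap r s) ^ 2

theorem IsSaturatedBy.swap {C : RankOnePOVM R d} {K : ι → R → ℝ} {L : κ → R → ℝ}
    {v : ι × κ → DensityOperator d} (h : C.IsSaturatedBy K L v) :
    C.IsSaturatedBy L K fun p => v p.swap := by
  intro k j s r hs hr
  rw [fidelityOperator_comm, overlap, norm_inner_symm]
  exact h hr hs

end RankOnePOVM

section UpperBound

open Matrix

variable {ι κ R : Type*} [Fintype ι] [Fintype κ] [Fintype R] {d : ℕ}

namespace POVM.IsCoarseGrainingBy

variable {A : POVM ι (Fin d)} {B : POVM κ (Fin d)} {C : RankOnePOVM R d} {K : ι → R → ℝ}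
  {L : κ → R → ℝ} (hA : A.IsCoarseGrainingBy C.toPOVM K) (hB : B.IsCoarseGrainingBy C.toPOVM L)
  (est : ι × κ → DensityOperator d)

include hA hB

theorem fidelityScore_eq_sum :
    A.fidelityScore B est = ∑ x : (ι × κ) × R × R, K x.1.1 x.2.1 * L x.1.2 x.2.2 *
      (C.weight x.2.1 * C.weight x.2.2 * ((est x.1).mat *
        fidelityOperator (ketBra (C.vec x.2.1)) (ketBra (C.vec x.2.2))).trace.re) := by
  refine (Finset.sum_congr rfl fun p _ => ?_).trans (Fintype.sum_prod_type _).symm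
  rw [hA.elem_eq, hB.elem_eq, Fintype.sum_prod_type]
  simp only [RankOnePOVM.toPOVM, smul_smul, ← Complex.ofReal_mul, map_sum, map_smul,
    LinearMap.sum_apply, LinearMap.smul_apply, Finset.mul_sum, Matrix.mul_smul, trace_sum,
    trace_smul, smul_eq_mul, Complex.re_sum, Complex.re_ofReal_mul]
  rw [Finset.sum_comm]
  exact Finset.sum_congr rfl fun r _ => Finset.sum_congr rfl fun s _ => by ring

theorem sum_optimal_eq :
    ∑ x : (ι × κ) × R × R, K x.1.1 x.2.1 * L x.1.2 x.2.2 *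
      (C.weight x.2.1 * C.weight x.2.2 * (1 + C.overlap x.2.1 x.2.2) ^ 2)
      = (d : ℝ) ^ 2 + d + 2 * C.overlapMoment 1 := by
  rw [← C.sum_weight_mul_one_add_overlap_sq]
  exact hA.sum_mul_mul hB fun q => C.weight q.1 * C.weight q.2 * (1 + C.overlap q.1 q.2) ^ 2

theorem mul_re_trace_le (x : (ι × κ) × R × R) :
    K x.1.1 x.2.1 * L x.1.2 x.2.2 * (C.weight x.2.1 * C.weight x.2.2 * ((est x.1).mat *
        fidelityOperator (ketBra (C.vec x.2.1)) (ketBra (C.vec x.2.2))).trace.re)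
      ≤ K x.1.1 x.2.1 * L x.1.2 x.2.2 *
        (C.weight x.2.1 * C.weight x.2.2 * (1 + C.overlap x.2.1 x.2.2) ^ 2) :=
  mul_le_mul_of_nonneg_left
    (mul_le_mul_of_nonneg_left
      ((est x.1).re_trace_mul_fidelityOperator_ketBra_le (C.norm_vec _) (C.norm_vec _))
      (mul_pos (C.weight_pos _) (C.weight_pos _)).le)
    (mul_nonneg (hA.nonneg _ _) (hB.nonneg _ _))

theorem fidelityScore_le_overlapMoment :
    A.fidelityScore B est ≤ (d : ℝ) ^ 2 + d + 2 * C.overlapMoment 1 := by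
  rw [hA.fidelityScore_eq_sum hB, ← hA.sum_optimal_eq hB]
  exact Finset.sum_le_sum fun x _ => hA.mul_re_trace_le hB est x

theorem isSaturatedBy (h : (d : ℝ) ^ 2 + d + 2 * C.overlapMoment 1 ≤ A.fidelityScore B est) :
    C.IsSaturatedBy K L est := by
  intro j k r s hr hs
  have heq := (hA.fidelityScore_le_overlapMoment hB est).antisymm h
  rw [hA.fidelityScore_eq_sum hB, ← hA.sum_optimal_eq hB,
    Finset.sum_eq_sum_iff_of_le fun x _ => hA.mul_re_trace_le hB est x] at heq
  have hpos := mul_pos (C.weight_pos r) (C.weight_pos s)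
  exact mul_left_cancel₀ hpos.ne'
    (mul_left_cancel₀ (mul_pos hr hs).ne' (heq ((j, k), r, s) (Finset.mem_univ _)))

theorem avgFidelity_prod_le_F2iid [NeZero d] : (A.prod B).avgFidelity est ≤ F2iid d := by
  have hscore := hA.fidelityScore_le_overlapMoment hB est
  have hmoment := C.overlapMoment_one_le
  rw [avgFidelity_prod, F2iid_eq]
  gcongr
  linarith

theorem overlap_and_isSaturatedBy_of_avgFidelity_prod_eq [NeZero d]
    (h : (A.prod B).avgFidelity est = F2iid d) :
    (∀ r s, C.overlap r s = 1 ∨ C.overlap r s = sicOverlap d) ∧ C.IsSaturatedBy K L est := by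
  have hd : (0 : ℝ) < d := Nat.cast_pos.mpr (NeZero.pos d)
  rw [avgFidelity_prod, F2iid_eq, div_left_inj' (by positivity), add_right_inj] at h
  have hscore := hA.fidelityScore_le_overlapMoment hB est
  have hmoment := C.overlapMoment_one_le
  exact ⟨C.overlap_eq_one_or_eq_sicOverlap (by linarith), hA.isSaturatedBy hB est (by linarith)⟩

end POVM.IsCoarseGrainingBy

theorem POVM.Compatible.estimationFidelity_prod_le [NeZero d] {A : POVM ι (Fin d)}
    {B : POVM κ (Fin d)} (h : A.Compatible B) : (A.prod B).estimationFidelity ≤ F2iid d := by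
  obtain ⟨R, _, C, K, L, hA, hB⟩ := h.exists_rankOnePOVM
  obtain ⟨v, hv⟩ := A.exists_avgFidelity_prod_eq_estimationFidelity B
  exact hv ▸ hA.avgFidelity_prod_le_F2iid hB _

end UpperBound

section EqualityCase

open Matrix

variable {ι κ R : Type*} [Fintype ι] [Fintype κ] [Fintype R] {d : ℕ}

theorem norm_inner_eq_one_of_re_trace_mul_fidelityOperator {x y : EuclideanSpace ℂ (Fin d)}
    (hx : ‖x‖ = 1) (hy : ‖y‖ = 1) (hxy : 0 < ‖inner ℂ x y‖) (v : PureState d)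
    (hxx : (ketBra v.1 * fidelityOperator (ketBra x) (ketBra x)).trace.re = 4)
    (h : (ketBra v.1 * fidelityOperator (ketBra x) (ketBra y)).trace.re
      = (1 + ‖inner ℂ x y‖) ^ 2) : ‖inner ℂ x y‖ = 1 := by
  rw [ketBra_eq_of_re_trace_mul_fidelityOperator_self hx v hxx,
    re_trace_ketBra_mul_fidelityOperator_ketBra_left hx hy] at h
  refine mul_left_cancel₀ hxy.ne' ?_
  linarith

namespace RankOnePOVM

variable (C : RankOnePOVM R d)

omit [Fintype ι] in
theorem overlap_eq_one_of_isSaturatedBy {A : POVM κ (Fin d)} {C : RankOnePOVM R d}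
    {K : ι → R → ℝ} {L : κ → R → ℝ} {v : ι × κ → PureState d}
    (hA : A.IsCoarseGrainingBy C.toPOVM L)
    (h : C.IsSaturatedBy K L fun p => (v p).toDensityOperator) {j : ι} {r s : R}
    (hpos : 0 < C.overlap r s) (hr : 0 < K j r) (hs : 0 < K j s) : C.overlap r s = 1 := by
  obtain ⟨k, hk⟩ := hA.exists_pos r
  have hrr := h hr hk
  have hrs := h hs hk
  rw [C.overlap_self] at hrr
  rw [fidelityOperator_comm, overlap, norm_inner_symm] at hrs
  refine norm_inner_eq_one_of_re_trace_mul_fidelityOperator (C.norm_vec r) (C.norm_vec s) hpos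
    (v (j, k)) (hrr.trans ?_) hrs
  norm_num

theorem weight_eq_one_div [NeZero d]
    (h : ∀ r s, r ≠ s → C.overlap r s ^ 2 = 1 / ((d : ℝ) + 1)) (r : R) :
    C.weight r = 1 / d := by
  classical
  have hd : (d : ℝ) ≠ 0 := NeZero.ne _
  have hrest : ∑ s ∈ Finset.univ.erase r, C.weight s * C.overlap r s ^ 2
      = (∑ s ∈ Finset.univ.erase r, C.weight s) * (1 / ((d : ℝ) + 1)) := by
    rw [Finset.sum_mul]
    exact Finset.sum_congr rfl fun s hs => by rw [h r s (Finset.ne_of_mem_erase hs).symm]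
  have hone := C.sum_weight_mul_overlap_sq r
  have htotal := C.sum_weight
  rw [← Finset.add_sum_erase _ _ (Finset.mem_univ r)] at hone htotal
  rw [hrest, C.overlap_self, eq_sub_of_add_eq' htotal] at hone
  field_simp at hone ⊢
  linarith

theorem elem_toPOVM_eq_one_div_smul [NeZero d]
    (h : ∀ r s, r ≠ s → C.overlap r s ^ 2 = 1 / ((d : ℝ) + 1)) (r : R) :
    C.toPOVM.elem r = (1 / (d : ℂ)) • ketBra (C.vec r) := by
  simp only [toPOVM, C.weight_eq_one_div h, Complex.ofReal_div, Complex.ofReal_one,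
    Complex.ofReal_natCast]

theorem isSIC_toPOVM [NeZero d] (h : ∀ r s, r ≠ s → C.overlap r s ^ 2 = 1 / ((d : ℝ) + 1)) :
    C.toPOVM.IsSIC := by
  refine ⟨?_, C.vec, C.norm_vec, h, C.elem_toPOVM_eq_one_div_smul h⟩
  have hd : (d : ℝ) ≠ 0 := NeZero.ne _
  have htotal := C.sum_weight
  simp only [C.weight_eq_one_div h, Finset.sum_const, Finset.card_univ, nsmul_eq_mul, mul_one_div,
    div_eq_iff hd] at htotal
  rw [sq]
  exact_mod_cast htotal

theorem overlap_ne_one_of_isSimple (hC : C.toPOVM.IsSimple) {r s : R} (hrs : r ≠ s) :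
    C.overlap r s ≠ 1 := by
  intro hone
  have hs : (C.weight s : ℂ) ≠ 0 := by exact_mod_cast (C.weight_pos s).ne'
  refine hC r s hrs (C.weight r / C.weight s) ?_
  simp only [toPOVM, smul_smul, div_mul_cancel₀ _ hs, C.ketBra_vec_eq_of_overlap_eq_one hone]

end RankOnePOVM

namespace POVM

theorem IsSimple.elem_ne_zero {n : Type*} [Fintype n] [DecidableEq n] [Nonempty n] {A : POVM ι n}
    (hA : A.IsSimple) (j : ι) : A.elem j ≠ 0 := by
  intro hj
  have hzero : ∀ k, A.elem k = 0 := by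
    intro k
    by_contra hk
    exact hA j k (fun h => hk (h ▸ hj)) 0 (by rw [hj, zero_smul])
  have hsum := A.sum_elem
  simp only [hzero, Finset.sum_const_zero] at hsum
  exact zero_ne_one hsum

theorem IsSimple.exists_rankOnePOVM [NeZero d] {A : POVM ι (Fin d)} (hA : A.IsSimple)
    {C : RankOnePOVM R d} {K : ι → R → ℝ} (hAC : A.IsCoarseGrainingBy C.toPOVM K)
    (hpar : ∀ j r s, 0 < K j r → 0 < K j s → C.overlap r s = 1) :
    ∃ (D : RankOnePOVM ι d) (f : ι → R), A = D.toPOVM ∧ (∀ j, D.vec j = C.vec (f j)) ∧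
      ∀ j, 0 < K j (f j) := by
  have hsupp : ∀ j, ∃ r, 0 < K j r := by
    intro j
    by_contra! hj
    refine hA.elem_ne_zero j ?_
    simp [hAC.elem_eq, fun r => (hj r).antisymm (hAC.nonneg j r)]
  choose f hf using hsupp
  have helem : ∀ j, A.elem j = ((∑ r, K j r * C.weight r : ℝ) : ℂ) • ketBra (C.vec (f j)) := by
    intro j
    rw [hAC.elem_eq, Complex.ofReal_sum, Finset.sum_smul]
    refine Finset.sum_congr rfl fun r _ => ?_
    rcases (hAC.nonneg j r).eq_or_lt with hr | hr
    · simp [← hr]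
    · rw [C.ketBra_vec_eq_of_overlap_eq_one (hpar j (f j) r (hf j) hr), Complex.ofReal_mul,
        mul_smul]
      rfl
  refine ⟨⟨fun j => ∑ r, K j r * C.weight r, fun j => C.vec (f j), fun j => ?_,
    fun j => C.norm_vec _, ?_⟩, f, ?_, fun j => rfl, hf⟩
  · exact Finset.sum_pos' (fun r _ => mul_nonneg (hAC.nonneg j r) (C.weight_pos r).le)
      ⟨f j, Finset.mem_univ _, mul_pos (hf j) (C.weight_pos _)⟩
  · simp only [← helem, A.sum_elem]
  · cases A
    congr
    exact funext helem

theorem IsSimple.isSIC_and_exists_elem_eq [NeZero d] {A : POVM ι (Fin d)} (hA : A.IsSimple)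
    {C : RankOnePOVM R d} {K : ι → R → ℝ} (hAC : A.IsCoarseGrainingBy C.toPOVM K)
    (hov : ∀ r s, C.overlap r s = 1 ∨ C.overlap r s = sicOverlap d)
    (hpar : ∀ j r s, 0 < K j r → 0 < K j s → C.overlap r s = 1) :
    A.IsSIC ∧ ∃ f : ι → R, ∀ j, 0 < K j (f j) ∧
      A.elem j = (1 / (d : ℂ)) • ketBra (C.vec (f j)) := by
  obtain ⟨D, f, rfl, hvec, hf⟩ := hA.exists_rankOnePOVM hAC hpar
  have hsq : ∀ j k, j ≠ k → D.overlap j k ^ 2 = 1 / ((d : ℝ) + 1) := by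
    intro j k hjk
    have hcases : D.overlap j k = 1 ∨ D.overlap j k = sicOverlap d := by
      simpa only [RankOnePOVM.overlap, hvec] using hov (f j) (f k)
    rw [hcases.resolve_left (D.overlap_ne_one_of_isSimple hA hjk), sicOverlap_sq]
  exact ⟨D.isSIC_toPOVM hsq, f, fun j => ⟨hf j, by rw [D.elem_toPOVM_eq_one_div_smul hsq, hvec]⟩⟩

theorem IsSimple.identicalUpToRelabeling {n : Type*} [Fintype n] [DecidableEq n] {A : POVM ι n}
    {B : POVM κ n} (hA : A.IsSimple) (hcard : Fintype.card ι = Fintype.card κ)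
    (h : ∀ j, ∃ k, A.elem j = B.elem k) : A.IdenticalUpToRelabeling B := by
  choose f hf using h
  have hinj : Function.Injective f := by
    intro j k hjk
    by_contra hne
    exact hA j k hne 1 (by rw [hf j, hf k, hjk, one_smul])
  exact ⟨Equiv.ofBijective f ((Fintype.bijective_iff_injective_and_card f).mpr ⟨hinj, hcard⟩), hf⟩

theorem IsSimple.isSIC_and_identical_of_isSaturatedBy [NeZero d] {A : POVM ι (Fin d)}
    {B : POVM κ (Fin d)} (hA : A.IsSimple) (hB : B.IsSimple) {C : RankOnePOVM R d}
    {K : ι → R → ℝ} {L : κ → R → ℝ} (hAC : A.IsCoarseGrainingBy C.toPOVM K)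
    (hBC : B.IsCoarseGrainingBy C.toPOVM L)
    (hov : ∀ r s, C.overlap r s = 1 ∨ C.overlap r s = sicOverlap d) {v : ι × κ → PureState d}
    (hv : C.IsSaturatedBy K L fun p => (v p).toDensityOperator) :
    A.IsSIC ∧ B.IsSIC ∧ A.IdenticalUpToRelabeling B := by
  have hpos : ∀ r s, 0 < C.overlap r s := by
    intro r s
    rcases hov r s with h | h <;> rw [h]
    exacts [one_pos, sicOverlap_pos d]
  have hparA : ∀ j r s, 0 < K j r → 0 < K j s → C.overlap r s = 1 := fun _ r s =>
    RankOnePOVM.overlap_eq_one_of_isSaturatedBy hBC hv (hpos r s)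
  have hparB : ∀ k r s, 0 < L k r → 0 < L k s → C.overlap r s = 1 := fun _ r s =>
    RankOnePOVM.overlap_eq_one_of_isSaturatedBy (v := fun p => v p.swap) hAC hv.swap (hpos r s)
  obtain ⟨hASIC, f, hf⟩ := hA.isSIC_and_exists_elem_eq hAC hov hparA
  obtain ⟨hBSIC, g, hg⟩ := hB.isSIC_and_exists_elem_eq hBC hov hparB
  refine ⟨hASIC, hBSIC, hA.identicalUpToRelabeling (hASIC.1.trans hBSIC.1.symm) fun j => ?_⟩
  obtain ⟨k, hk⟩ := hBC.exists_pos (f j)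
  refine ⟨k, ?_⟩
  rw [(hf j).2, (hg k).2, C.ketBra_vec_eq_of_overlap_eq_one (hparB k _ _ hk (hg k).1)]

theorem Compatible.isSIC_and_identical_of_estimationFidelity_eq [NeZero d] {A : POVM ι (Fin d)}
    {B : POVM κ (Fin d)} (h : A.Compatible B) (hA : A.IsSimple) (hB : B.IsSimple)
    (heq : (A.prod B).estimationFidelity = F2iid d) :
    A.IsSIC ∧ B.IsSIC ∧ A.IdenticalUpToRelabeling B := by
  obtain ⟨R, _, C, K, L, hAC, hBC⟩ := h.exists_rankOnePOVM
  obtain ⟨v, hv⟩ := A.exists_avgFidelity_prod_eq_estimationFidelity B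
  obtain ⟨hov, hsat⟩ :=
    hAC.overlap_and_isSaturatedBy_of_avgFidelity_prod_eq hBC _ (hv.trans heq)
  exact hA.isSIC_and_identical_of_isSaturatedBy hB hAC hBC hov hsat

end POVM

end EqualityCase

section Attainment

open Matrix

variable {ι κ R : Type*} [Fintype ι] [Fintype κ] [Fintype R] {d : ℕ}

namespace RankOnePOVM

variable (C : RankOnePOVM R d)

theorem exists_fidelityScore_toPOVM_self_eq :
    ∃ est, C.toPOVM.fidelityScore C.toPOVM est = (d : ℝ) ^ 2 + d + 2 * C.overlapMoment 1 := by
  choose v hv using fun p : R × R =>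
    exists_re_trace_ketBra_mul_fidelityOperator_ketBra_eq (C.norm_vec p.1) (C.norm_vec p.2)
  refine ⟨fun p => (v p).toDensityOperator, ?_⟩
  rw [← C.sum_weight_mul_one_add_overlap_sq]
  refine Finset.sum_congr rfl fun p _ => ?_
  simp only [PureState.toDensityOperator, toPOVM, map_smul, LinearMap.smul_apply, smul_smul,
    Matrix.mul_smul, trace_smul, smul_eq_mul, ← Complex.ofReal_mul, Complex.re_ofReal_mul, hv,
    overlap]
  ring

theorem overlapMoment_one_eq [NeZero d] (h : ∀ r s, r ≠ s → C.overlap r s = sicOverlap d) :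
    C.overlapMoment 1 = 1 + ((d : ℝ) ^ 2 - 1) * sicOverlap d := by
  classical
  have hd : (d : ℝ) ≠ 0 := NeZero.ne _
  have hov : ∀ r s, C.overlap r s = sicOverlap d + if r = s then 1 - sicOverlap d else 0 := by
    intro r s
    split_ifs with hrs
    · rw [hrs, C.overlap_self, add_sub_cancel]
    · rw [h r s hrs, add_zero]
  have hw := C.weight_eq_one_div fun r s hrs => by rw [h r s hrs, sicOverlap_sq]
  have hdiag : ∑ r, C.weight r * C.weight r = 1 := by
    calc ∑ r, C.weight r * C.weight r = ∑ r, 1 / (d : ℝ) * C.weight r :=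
          Finset.sum_congr rfl fun r _ => by rw [hw r]
      _ = 1 := by rw [← Finset.mul_sum, C.sum_weight, one_div, inv_mul_cancel₀ hd]
  have hfull := C.overlapMoment_zero
  simp only [overlapMoment, pow_zero, mul_one] at hfull
  simp only [overlapMoment, pow_one, hov, mul_add, Finset.sum_add_distrib, ← Finset.sum_mul, hfull]
  simp only [Fintype.sum_prod_type, mul_ite, mul_zero, Finset.sum_ite_eq, Finset.mem_univ, if_true,
    ← Finset.sum_mul, hdiag]
  ring

end RankOnePOVM

namespace POVM

theorem IsSIC.exists_rankOnePOVM [NeZero d] {A : POVM ι (Fin d)} (hA : A.IsSIC) :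
    ∃ C : RankOnePOVM ι d, A = C.toPOVM ∧ ∀ r s, r ≠ s → C.overlap r s = sicOverlap d := by
  obtain ⟨-, ψ, hψ, hov, hAψ⟩ := hA
  have hd : (0 : ℝ) < d := Nat.cast_pos.mpr (NeZero.pos d)
  have helem : ∀ j, A.elem j = (((1 / d : ℝ)) : ℂ) • ketBra (ψ j) := by simpa using hAψ
  refine ⟨⟨fun _ => 1 / d, ψ, fun _ => by positivity, hψ, ?_⟩, ?_, fun r s hrs => ?_⟩
  · simp only [← helem, A.sum_elem]
  · cases A
    congr
    exact funext helem
  · refine (pow_left_inj₀ (norm_nonneg _) (sicOverlap_pos d).le two_ne_zero).mp ?_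
    rw [hov r s hrs, sicOverlap_sq]

theorem fidelityScore_relabel (A : POVM ι (Fin d)) {B : POVM κ (Fin d)} (e : ι ≃ κ)
    (h : ∀ j, A.elem j = B.elem (e j)) (est : ι × ι → DensityOperator d) :
    A.fidelityScore B (fun p => est (p.1, e.symm p.2)) = A.fidelityScore A est := by
  rw [fidelityScore, ← Equiv.sum_comp ((Equiv.refl ι).prodCongr e)]
  simp [fidelityScore, h]

theorem IsSIC.F2iid_le_estimationFidelity_prod [NeZero d] {A : POVM ι (Fin d)}
    {B : POVM κ (Fin d)} (hA : A.IsSIC) (hAB : A.IdenticalUpToRelabeling B) :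
    F2iid d ≤ (A.prod B).estimationFidelity := by
  obtain ⟨C, rfl, hov⟩ := hA.exists_rankOnePOVM
  obtain ⟨e, he⟩ := hAB
  obtain ⟨est, hest⟩ := C.exists_fidelityScore_toPOVM_self_eq
  refine le_of_eq_of_le ?_ (C.toPOVM.avgFidelity_prod_le_estimationFidelity B
    fun p => est (p.1, e.symm p.2))
  rw [avgFidelity_prod, fidelityScore_relabel _ e he, hest, C.overlapMoment_one_eq hov, F2iid_eq]

end POVM

end Attainment

theorem theorem6 {d : ℕ} (hd : 1 ≤ d) {ι κ : Type*} [Fintype ι] [Fintype κ]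
    (A : POVM ι (Fin d)) (B : POVM κ (Fin d)) :
    (A.Compatible B →
      (A.prod B).estimationFidelity ≤ F2iid d ∧
      (A.IsSimple → B.IsSimple →
        ((A.prod B).estimationFidelity = F2iid d ↔
          A.IsSIC ∧ B.IsSIC ∧ A.IdenticalUpToRelabeling B))) ∧
    (F2iid d < (A.prod B).estimationFidelity → ¬ A.Compatible B) := by
  have : NeZero d := ⟨by omega⟩
  refine ⟨fun h => ⟨h.estimationFidelity_prod_le, fun hA hB => ⟨?_, fun hS => ?_⟩⟩,
    fun hlt h => hlt.not_ge h.estimationFidelity_prod_le⟩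
  · exact h.isSIC_and_identical_of_estimationFidelity_eq hA hB
  · exact h.estimationFidelity_prod_le.antisymm (hS.1.F2iid_le_estimationFidelity_prod hS.2.2)
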